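/- Let $d\in\{1,2,3\}$, put $\omega_d=\sqrt{-d}$ for $d\in\{1,2\}$ and $\omega_3=\frac{1+\sqrt{-3}}2$, and let $\mathcal O_d=\mathbb Z[\omega_d]$ be the ring of integers of $\mathbb Q(\sqrt{-d})$. Let $\mathcal E_d$ be the Farey graph: its vertices are the points of the orbit of $\infty$ under the Möbius action of $\mathrm{SL}(2,\mathcal O_d)$ on $\mathbb C\cup\{\infty\}$, and its edges are $A(\infty)\to A(0)$ with $A\in \mathrm{SL}(2,\mathcal O_d)$ (this relation is symmetric). A geodesic path in $\mathcal E_d$ is a path that has minimal length among all walks between its end points. Let $U_1=\{x+yi: -\frac12\le x<\frac12,\ -\frac12\le y<\frac12\}$, $U_2=\{x+yi: -\frac12\le x<\frac12,\ -\frac{\sqrt2}2\le y<\frac{\sqrt2}2\}$, and let $U_3$ be the half-open hexagon $\{x+yi: x,\ \frac{x+\sqrt3y}{2},\ \frac{-x+\sqrt3y}{2}\in[-\frac12,\frac12)\}$, which has vertices $(\pm\frac12,\pm\frac1{2\sqrt3})$, $(0,\pm\frac1{\sqrt3})$ and contains its left side and its two bottom sides with the two vertices at which these sides meet. The nearest integer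 continued fraction map $T_d\colon U_d\to U_d$ is $T_d(0)=0$ and $T_d(z)=\frac1z-a_d(z)$ for $z\neq0$, where $a_d(z)$ is the unique element of $\mathcal O_d$ with $\frac1z-a_d(z)\in U_d$. The nearest integer continued fraction expansion of $z\in U_d$ is $[0;a_1,a_2,\ldots]$ with $a_n=a_d(T_d^{\,n-1}(z))$; it stops after $a_N$ if $N$ is the least integer with $T_d^N(z)=0$, and is infinite if there is no such $N$. Let $\frac{P_n}{Q_n}=[0;a_1,\ldots,a_n]$ be its convergents, so $\frac{P_0}{Q_0}=0$. **Theorem.** Let $d\in\{1,2,3\}$ and $z\in U_d$. Then the nearest integer continued fraction expansion of $z$ is an expansion of $z$ (if it is finite, its last convergent is $z$; if it is infinite, its convergents tend to $z$), and it is geodesic: for every $n\ge0$ for which $\frac{P_n}{Q_n}$ is defined, $$\infty\to 0=\tfrac{P_0}{Q_0}\to\tfrac{P_1}{Q_1}\to\cdots\to\tfrac{P_n}{Q_n}$$ is a geodesic path in $\mathcal E_d$. If moreover $z\in\mathbb Q(\sqrt{-d})$, then the expansion is finite; so the walk $\infty\to0\to\frac{P_1}{Q_1}\to\cdots\to z$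 given by the whole expansion is a shortest walk from $\infty$ to $z$ in $\mathcal E_d$. -/

import Mathlib

open scoped OnePoint MatrixGroups

noncomputable section

namespace FareyCF

/-- The standard generator `ω_d` of the ring of integers of `ℚ(√-d)`, for `d` squarefree:
`√-d` if `d ≢ 3 mod 4`, and `(1 + √-d) / 2` if `d ≡ 3 mod 4`. -/
def omega (d : ℕ) : ℂ :=
  if d % 4 = 3 then (1 + (Real.sqrt d : ℂ) * Complex.I) / 2 else (Real.sqrt d : ℂ) * Complex.I

/-- The ring `ℤ[ω_d]`, as a subring of `ℂ`. -/
def ringO (d : ℕ) : Subring ℂ := Subring.closure {omega d}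

/-- The field `ℚ(√-d)`, as a subfield of `ℂ`. -/
def fieldK (d : ℕ) : IntermediateField ℚ ℂ :=
  IntermediateField.adjoin ℚ {(Real.sqrt d : ℂ) * Complex.I}

/-! ### The Farey graph -/

/-- The Möbius transformation of `ℂ ∪ {∞}` given by a matrix in `SL(2, ℤ[ω_d])`. -/
def moebius {d : ℕ} (A : SL(2, ringO d)) (x : OnePoint ℂ) : OnePoint ℂ :=
  (A.map (ringO d).subtype : GL (Fin 2) ℂ) • x

/-- The vertices of the Farey graph: the orbit of `∞` under the Bianchi group. -/
def FareyVertex (d : ℕ) : Type :=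
  {x : OnePoint ℂ // ∃ A : SL(2, ringO d), moebius A ∞ = x}

/-- The vertex `∞`. -/
def FareyVertex.infty (d : ℕ) : FareyVertex d :=
  ⟨∞, 1, by simp [moebius]⟩

theorem moebius_infty_ne_zero {d : ℕ} (A : SL(2, ringO d)) :
    moebius A ∞ ≠ moebius A ((0 : ℂ) : OnePoint ℂ) := by
  intro h
  exact OnePoint.infty_ne_coe _ (MulAction.injective _ h)

/-- The matrix `S = (0, -1; 1, 0)`, which swaps `∞` and `0`. -/
def swapS (d : ℕ) : SL(2, ringO d) := ⟨!![0, -1; 1, 0], by simp [Matrix.det_fin_two]⟩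

theorem moebius_mul {d : ℕ} (A B : SL(2, ringO d)) (x : OnePoint ℂ) :
    moebius (A * B) x = moebius A (moebius B x) := by
  simp [moebius, mul_smul]

theorem moebius_infty {d : ℕ} (A : SL(2, ringO d)) :
    moebius A ∞ = if (A.1 1 0 : ℂ) = 0 then ∞ else (((A.1 0 0 : ℂ) / A.1 1 0 : ℂ) : OnePoint ℂ) :=
  OnePoint.smul_infty_eq_ite _

theorem moebius_coe {d : ℕ} (A : SL(2, ringO d)) (x : ℂ) :
    moebius A (x : OnePoint ℂ) = if (A.1 1 0 : ℂ) * x + A.1 1 1 = 0 then ∞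
      else ((((A.1 0 0 : ℂ) * x + A.1 0 1) / ((A.1 1 0 : ℂ) * x + A.1 1 1) : ℂ) : OnePoint ℂ) :=
  OnePoint.smul_some_eq_ite

theorem moebius_swapS_infty (d : ℕ) :
    moebius (swapS d) ∞ = ((0 : ℂ) : OnePoint ℂ) := by
  rw [moebius_infty]
  simp [swapS]

theorem moebius_swapS_zero (d : ℕ) :
    moebius (swapS d) ((0 : ℂ) : OnePoint ℂ) = ∞ := by
  rw [moebius_coe]
  simp [swapS]

/-- The Farey graph `ℰ_d`: its edges are `A(∞) → A(0)` for `A` in the Bianchi group. The edge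
relation is symmetric, so that this is a simple graph. -/
def fareyGraph (d : ℕ) : SimpleGraph (FareyVertex d) where
  Adj u v := ∃ A : SL(2, ringO d), moebius A ∞ = u.1 ∧ moebius A ((0 : ℂ) : OnePoint ℂ) = v.1
  symm := ⟨by
    rintro u v ⟨A, hu, hv⟩
    refine ⟨A * swapS d, ?_, ?_⟩
    · rw [moebius_mul, moebius_swapS_infty, hv]
    · rw [moebius_mul, moebius_swapS_zero, hu]⟩
  loopless := ⟨by
    rintro u ⟨A, hu, hv⟩
    exact moebius_infty_ne_zero A (hu.trans hv.symm)⟩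

/-- A geodesic path in a graph: a path which is a shortest walk between its end points. -/
def IsGeodesicPath {V : Type*} {G : SimpleGraph V} {u v : V} (w : G.Walk u v) : Prop :=
  w.IsPath ∧ ∀ w' : G.Walk u v, w.length ≤ w'.length

/-! ### Continued fractions with coefficients in `ℤ[ω_d]`

A continued fraction `[a₀; a₁, a₂, …]`, finite or infinite, is Mathlib's `SimpContFract ℂ`, with
head term `a₀` and `a₁, a₂, …` the partial denominators. It has at least `n + 1` coefficients
`a₀, …, aₙ` if and only if it is not terminated at any `k < n`. -/

/-- The `n`-th convergent `pₙ / qₙ`, as a point of `ℂ ∪ {∞}`. -/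
def convergent (g : SimpContFract ℂ) (n : ℕ) : OnePoint ℂ :=
  if g.1.dens n = 0 then ∞ else ((g.1.nums n / g.1.dens n : ℂ) : OnePoint ℂ)

/-- `g` is a continued fraction expansion of `z` with coefficients in `ℤ[ω_d]`: if `g` is finite,
its value (its last convergent) is `z`, and if `g` is infinite, its convergents tend to `z`. -/
structure IsExpansion (d : ℕ) (g : SimpContFract ℂ) (z : ℂ) : Prop where
  head_mem : g.1.h ∈ ringO d
  coeff_mem : ∀ (k : ℕ) (a : ℂ), g.1.partDens.get? k = some a → a ∈ ringO d
  finite_value : ∀ n : ℕ, (∀ k < n, ¬ g.1.TerminatedAt k) → g.1.TerminatedAt n →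
    convergent g n = (z : OnePoint ℂ)
  infinite_value : ¬ g.1.Terminates →
    Filter.Tendsto (convergent g) Filter.atTop (nhds (z : OnePoint ℂ))

/-- `g` is geodesic in `ℰ_d`: for every `n` for which `pₙ / qₙ` is defined,
`∞ → p₀/q₀ → p₁/q₁ → ⋯ → pₙ/qₙ` is a geodesic path in `ℰ_d`. -/
def IsGeodesic (d : ℕ) (g : SimpContFract ℂ) : Prop :=
  ∀ n : ℕ, (∀ k < n, ¬ g.1.TerminatedAt k) →
    ∃ (v : FareyVertex d) (w : (fareyGraph d).Walk (FareyVertex.infty d) v),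
      w.support.map Subtype.val = ∞ :: (List.range (n + 1)).map (convergent g) ∧
      IsGeodesicPath w

/-! ### The nearest integer continued fraction algorithms -/

/-- The fundamental domains `U_1`, `U_2` (half-open rectangles) and `U_3` (the half-open hexagon
with vertices `(±1/2, ±1/(2√3))` and `(0, ±1/√3)`, including its left and its two bottom sides with
the two vertices at which these sides meet). -/
def domainU (d : ℕ) : Set ℂ :=
  match d with
  | 1 => {z | z.re ∈ Set.Ico (-(1 / 2)) (1 / 2) ∧ z.im ∈ Set.Ico (-(1 / 2)) (1 / 2)}
  | 2 => {z | z.re ∈ Set.Ico (-(1 / 2)) (1 / 2) ∧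
      z.im ∈ Set.Ico (-(Real.sqrt 2 / 2)) (Real.sqrt 2 / 2)}
  | 3 => {z | z.re ∈ Set.Ico (-(1 / 2)) (1 / 2) ∧
      z.re / 2 + Real.sqrt 3 / 2 * z.im ∈ Set.Ico (-(1 / 2)) (1 / 2) ∧
      -z.re / 2 + Real.sqrt 3 / 2 * z.im ∈ Set.Ico (-(1 / 2)) (1 / 2)}
  | _ => ∅

/-- The coefficient `a_d(z)` for `z ≠ 0`: the element `a` of `ℤ[ω_d]` with `1/z - a ∈ U_d`. For
`d ∈ {1, 2, 3}` there is exactly one, because `U_d` is a fundamental domain of `ℂ / ℤ[ω_d]`. -/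
def coeff (d : ℕ) (z : ℂ) : ℂ :=
  Classical.epsilon fun a : ℂ => a ∈ ringO d ∧ 1 / z - a ∈ domainU d

/-- The nearest integer continued fraction map `T_d`. -/
def mapT (d : ℕ) (z : ℂ) : ℂ := if z = 0 then 0 else 1 / z - coeff d z

theorem mapT_iterate_eq_zero {d : ℕ} {z : ℂ} {k : ℕ} (h : (mapT d)^[k] z = 0) :
    (mapT d)^[k + 1] z = 0 := by
  rw [Function.iterate_succ_apply', h]
  simp [mapT]

open Classical in
/-- The nearest integer continued fraction expansion `[0; a₁, a₂, …]` of `z ∈ U_d`, where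
`aₙ = a_d(T_d^{n-1}(z))`. It stops at the first `n` with `T_d^n(z) = 0`. -/
def nicf (d : ℕ) (z : ℂ) : SimpContFract ℂ :=
  ⟨{ h := 0
     s := ⟨fun k => if (mapT d)^[k] z = 0 then none else some ⟨1, coeff d ((mapT d)^[k] z)⟩, by
       intro k hk
       have h : (mapT d)^[k] z = 0 := by
         by_contra h
         simp [h] at hk
       exact if_pos (mapT_iterate_eq_zero h)⟩ }, by
    intro k a h
    rw [GenContFract.partNums, Stream'.Seq.map_get?] at h
    obtain ⟨p, hp, rfl⟩ := Option.map_eq_some_iff.1 h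
    change (if (mapT d)^[k] z = 0 then none else some _) = some p at hp
    split_ifs at hp
    cases hp
    rfl⟩

end FareyCF

end

open scoped ComplexConjugate

namespace FareyCF

/-! ### The ring `ℤ[ω_d]` -/

/-! The heart is the bound that a walk from `∞` to a convergent of index `n` has at least `n + 1`
steps. It is proved by induction on `n`, using the reflections `w ↦ g - (g / ḡ) w̄` in the bisectors
of `0` and a Voronoi vector `g`, which preserve the lattice and the Farey graph.

A walk leaves `∞` through a lattice point `b` (`succ_le_of_chain_infty`), so `b` has to be at
distance at least `n` from the convergent. If `b = 0`, the map `w ↦ 1/w - a₁` sends `b` to `∞` and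
the convergent to one of index `n - 1`, and induction applies. If `b ≠ 0`, then `b` lies strictly
beyond some bisector, and reflection brings it closer to `0`. When the convergent is not strictly
beyond that bisector, the walk is folded back (`Chain.fold`). Otherwise the whole walk is reflected,
and the new end point must again be a convergent of `z` of index `n`; this is `IsNearConv.reflect`.
The descent is `IsNearConv.le_of_chain`.

For `IsNearConv.reflect`, the mirror is pulled back through the coefficients as a Hermitian form of
fixed discriminant. When it first puts `0` strictly on the negative side, it is either the unit
circle, which the remainder cannot be outside, or a bisector that passes through the remainder. The
latter is a tie, and the reflected convergent belongs to the other choice `a + g`. Hence expansions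
with remainders in the closed cell and arbitrary choices at ties are the right class for the
induction.

Convergence follows because `|qₙ z - pₙ|` is the product of the moduli of the remainders and `|qₙ| ≥
1`; finiteness is the Euclidean algorithm. -/

theorem omega_one : omega 1 = Complex.I := by simp [omega]

theorem omega_two : omega 2 = (Real.sqrt 2 : ℂ) * Complex.I := by simp [omega]

theorem omega_three : omega 3 = (1 + (Real.sqrt 3 : ℂ) * Complex.I) / 2 := by simp [omega]

theorem omega_quadratic {d : ℕ} (hd : d = 1 ∨ d = 2 ∨ d = 3) :
    ∃ t N : ℤ, omega d * omega d = t * omega d - N ∧ conj (omega d) = t - omega d := by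
  have h2 : ((Real.sqrt 2 : ℝ) : ℂ) ^ 2 = 2 := by
    rw [← Complex.ofReal_pow, Real.sq_sqrt (by norm_num)]; norm_num
  have h3 : ((Real.sqrt 3 : ℝ) : ℂ) ^ 2 = 3 := by
    rw [← Complex.ofReal_pow, Real.sq_sqrt (by norm_num)]; norm_num
  rcases hd with rfl | rfl | rfl
  · exact ⟨0, 1, by simp [omega_one], by simp [omega_one]⟩
  · refine ⟨0, 2, ?_, by simp [omega_two]⟩
    rw [omega_two]; push_cast
    linear_combination (Complex.I ^ 2) * h2 + 2 * Complex.I_sq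
  · refine ⟨1, 1, ?_, ?_⟩
    · rw [omega_three]; push_cast
      linear_combination (Complex.I ^ 2 / 4) * h3 + (3 / 4) * Complex.I_sq
    · rw [omega_three]
      simp only [map_div₀, map_add, map_one, map_mul, Complex.conj_ofReal, Complex.conj_I,
        map_ofNat]
      push_cast; ring

theorem mem_ringO {d : ℕ} (hd : d = 1 ∨ d = 2 ∨ d = 3) {z : ℂ} :
    z ∈ ringO d ↔ ∃ m n : ℤ, z = m + n * omega d := by
  constructor
  · intro hz
    obtain ⟨t, N, hω, -⟩ := omega_quadratic hd
    refine Subring.closure_induction (p := fun z _ => ∃ m n : ℤ, z = m + n * omega d)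
      ?_ ⟨0, 0, by simp⟩ ⟨1, 0, by simp⟩ ?_ ?_ ?_ hz
    · rintro x rfl
      exact ⟨0, 1, by simp⟩
    · rintro _ _ _ _ ⟨m, n, rfl⟩ ⟨m', n', rfl⟩
      exact ⟨m + m', n + n', by push_cast; ring⟩
    · rintro _ _ ⟨m, n, rfl⟩
      exact ⟨-m, -n, by push_cast; ring⟩
    · rintro _ _ _ _ ⟨m, n, rfl⟩ ⟨m', n', rfl⟩
      refine ⟨m * m' - n * n' * N, m * n' + n * m' + n * n' * t, ?_⟩
      push_cast
      linear_combination (n * n' : ℂ) * hω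
  · rintro ⟨m, n, rfl⟩
    exact add_mem (intCast_mem _ m)
      (mul_mem (intCast_mem _ n) (Subring.subset_closure rfl))

theorem mem_ringO_one {z : ℂ} : z ∈ ringO 1 ↔ ∃ m n : ℤ, z.re = m ∧ z.im = n := by
  rw [mem_ringO (by simp)]
  simp [omega_one, Complex.ext_iff]

theorem mem_ringO_two {z : ℂ} :
    z ∈ ringO 2 ↔ ∃ m n : ℤ, z.re = m ∧ z.im = n * Real.sqrt 2 := by
  rw [mem_ringO (by simp)]
  simp [omega_two, Complex.ext_iff]

theorem mem_ringO_three {z : ℂ} :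
    z ∈ ringO 3 ↔ ∃ m n : ℤ, z.re = m + n / 2 ∧ z.im = n * (Real.sqrt 3 / 2) := by
  rw [mem_ringO (by simp)]
  have h : (omega 3).re = 1 / 2 ∧ (omega 3).im = Real.sqrt 3 / 2 := by
    rw [omega_three]
    constructor
    · rw [Complex.div_ofNat_re]; simp
    · rw [Complex.div_ofNat_im]; simp
  simp [h.1, h.2, Complex.ext_iff, div_eq_mul_inv]

theorem conj_mem_ringO {d : ℕ} (hd : d = 1 ∨ d = 2 ∨ d = 3) {z : ℂ} (hz : z ∈ ringO d) :
    conj z ∈ ringO d := by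
  obtain ⟨t, N, -, hω⟩ := omega_quadratic hd
  obtain ⟨m, n, rfl⟩ := (mem_ringO hd).1 hz
  refine (mem_ringO hd).2 ⟨m + n * t, -n, ?_⟩
  simp only [map_add, map_mul, map_intCast, hω]
  push_cast; ring

theorem exists_two_mul_re_eq_intCast {d : ℕ} (hd : d = 1 ∨ d = 2 ∨ d = 3) {z : ℂ}
    (hz : z ∈ ringO d) : ∃ n : ℤ, 2 * z.re = n := by
  rcases hd with rfl | rfl | rfl
  · obtain ⟨m, n, h, -⟩ := mem_ringO_one.1 hz
    exact ⟨2 * m, by rw [h]; push_cast; ring⟩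
  · obtain ⟨m, n, h, -⟩ := mem_ringO_two.1 hz
    exact ⟨2 * m, by rw [h]; push_cast; ring⟩
  · obtain ⟨m, n, h, -⟩ := mem_ringO_three.1 hz
    exact ⟨2 * m + n, by rw [h]; push_cast; ring⟩

theorem exists_normSq_eq_intCast {d : ℕ} (hd : d = 1 ∨ d = 2 ∨ d = 3) {z : ℂ}
    (hz : z ∈ ringO d) : ∃ n : ℤ, Complex.normSq z = n := by
  have h2 : Real.sqrt 2 ^ 2 = 2 := Real.sq_sqrt (by norm_num)
  have h3 : Real.sqrt 3 ^ 2 = 3 := Real.sq_sqrt (by norm_num)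
  rcases hd with rfl | rfl | rfl
  · obtain ⟨m, n, h, h'⟩ := mem_ringO_one.1 hz
    exact ⟨m * m + n * n, by rw [Complex.normSq_apply, h, h']; push_cast; ring⟩
  · obtain ⟨m, n, h, h'⟩ := mem_ringO_two.1 hz
    refine ⟨m * m + 2 * n * n, ?_⟩
    rw [Complex.normSq_apply, h, h']; push_cast
    linear_combination (n : ℝ) ^ 2 * h2
  · obtain ⟨m, n, h, h'⟩ := mem_ringO_three.1 hz
    refine ⟨m * m + m * n + n * n, ?_⟩
    rw [Complex.normSq_apply, h, h']; push_cast
    linear_combination (n : ℝ) ^ 2 / 4 * h3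

theorem one_le_normSq {d : ℕ} (hd : d = 1 ∨ d = 2 ∨ d = 3) {z : ℂ}
    (hz : z ∈ ringO d) (h0 : z ≠ 0) : 1 ≤ Complex.normSq z := by
  obtain ⟨n, hn⟩ := exists_normSq_eq_intCast hd hz
  have := Complex.normSq_pos.2 h0
  rw [hn] at this ⊢
  exact_mod_cast this

/-! ### Lattice mirrors and the closed Voronoi cell -/

/-- The Voronoi vectors `g` of `ℤ[ω_d]`: the perpendicular bisectors of `0` and `g` are the lines
that bound the domain `U_d`. -/
def mirrorVec (d : ℕ) : Set ℂ :=
  {g | g ∈ ringO d ∧ (Complex.normSq g = 1 ∨ d = 2 ∧ Complex.normSq g = 2)}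

/-- The closure of `U_d`, as an intersection of half-planes. -/
def closedU (d : ℕ) : Set ℂ := {z | ∀ g ∈ mirrorVec d, 2 * (z / g).re ≤ 1}

/-- The dual lattice of `ℤ[ω_d]` with respect to the pairing `2 Re (β w)`. -/
def IsDual (d : ℕ) (β : ℂ) : Prop := ∀ w ∈ ringO d, ∃ n : ℤ, 2 * (β * w).re = n

theorem ne_zero_of_mem_mirrorVec {d : ℕ} {g : ℂ} (hg : g ∈ mirrorVec d) : g ≠ 0 := by
  rintro rfl
  rcases hg.2 with h | h <;> simp at h

theorem mul_conj_mem_mirrorVec {d : ℕ} (hd : d = 1 ∨ d = 2 ∨ d = 3) {g u : ℂ}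
    (hg : g ∈ mirrorVec d) (hu : u ∈ ringO d) (hu1 : Complex.normSq u = 1) :
    u * conj g ∈ mirrorVec d := by
  refine ⟨mul_mem hu (conj_mem_ringO hd hg.1), ?_⟩
  rw [Complex.normSq_mul, Complex.normSq_conj, hu1, one_mul]
  exact hg.2

theorem mul_conj_mem_closedU {d : ℕ} (hd : d = 1 ∨ d = 2 ∨ d = 3) {z u : ℂ}
    (hz : z ∈ closedU d) (hu : u ∈ ringO d) (hu1 : Complex.normSq u = 1) :
    u * conj z ∈ closedU d := by
  intro g hg
  have h := hz _ (mul_conj_mem_mirrorVec hd hg hu hu1)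
  have hu0 : u ≠ 0 := by rintro rfl; simp at hu1
  have hg0 := ne_zero_of_mem_mirrorVec hg
  have hcg0 : conj g ≠ 0 := by simpa using hg0
  have huu : conj u * u = 1 := by rw [mul_comm, Complex.mul_conj, hu1]; simp
  have hcu : conj u = 1 / u := by field_simp; exact huu
  have e : z / (u * conj g) = conj (u * conj z / g) := by
    simp only [map_div₀, map_mul, Complex.conj_conj]
    rw [hcu]; field_simp
  rwa [e, Complex.conj_re] at h

theorem isDual_conj {d : ℕ} (hd : d = 1 ∨ d = 2 ∨ d = 3) {β : ℂ} (h : IsDual d β) :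
    IsDual d (conj β) := by
  intro w hw
  obtain ⟨n, hn⟩ := h _ (conj_mem_ringO hd hw)
  refine ⟨n, ?_⟩
  rw [← hn, ← Complex.conj_re]
  simp

theorem isDual_of_mem_ringO {d : ℕ} (hd : d = 1 ∨ d = 2 ∨ d = 3) {β : ℂ} (h : β ∈ ringO d) :
    IsDual d β := fun _ hw => exists_two_mul_re_eq_intCast hd (mul_mem h hw)

theorem isDual_add {d : ℕ} {β γ : ℂ} (h : IsDual d β) (h' : IsDual d γ) : IsDual d (β + γ) := by
  intro w hw
  obtain ⟨m, hm⟩ := h w hw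
  obtain ⟨n, hn⟩ := h' w hw
  refine ⟨m + n, ?_⟩
  rw [add_mul, Complex.add_re]; push_cast; linarith

theorem inv_eq_conj_of_normSq_eq_one {u : ℂ} (h : Complex.normSq u = 1) : u⁻¹ = conj u := by
  rw [Complex.inv_def, h]; simp

/-- Identifies the lines met in `IsNearConv.reflect` as translates of bisectors. The integers `s = 2
Re β` and `t = 2 Re (β ω)` satisfy a definite quadratic equation, whose few solutions are units, or
`±1/√-2` in the second case. -/
theorem inv_mem_mirrorVec_of_isDual {d : ℕ} (hd : d = 1 ∨ d = 2 ∨ d = 3) {β : ℂ}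
    (h : IsDual d β) (hβ : Complex.normSq β = 1 ∨ d = 2 ∧ Complex.normSq β = 1 / 2) :
    β⁻¹ ∈ mirrorVec d := by
  have h2 : Real.sqrt 2 ^ 2 = 2 := Real.sq_sqrt (by norm_num)
  have h3 : Real.sqrt 3 ^ 2 = 3 := Real.sq_sqrt (by norm_num)
  refine ⟨?_, ?_⟩
  swap
  · rw [Complex.normSq_inv]
    rcases hβ with hβ | ⟨h', hβ⟩
    · left; rw [hβ]; norm_num
    · right; rw [hβ]; norm_num [h']
  rcases hd with rfl | rfl | rfl
  · have hβ : Complex.normSq β = 1 := by simpa using hβ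
    obtain ⟨s, hs⟩ := h 1 (one_mem _)
    obtain ⟨t, ht⟩ := h Complex.I (mem_ringO_one.2 ⟨0, 1, by simp, by simp⟩)
    simp at hs ht
    rw [inv_eq_conj_of_normSq_eq_one hβ]
    rw [Complex.normSq_apply] at hβ
    have e : s * s + t * t = 4 := by
      have : (s : ℝ) * s + t * t = 4 := by rw [← hs, ← ht]; linarith
      exact_mod_cast this
    have hs2 : s ≤ 2 := by nlinarith
    have hs2' : -2 ≤ s := by nlinarith
    have ht2 : t ≤ 2 := by nlinarith
    have ht2' : -2 ≤ t := by nlinarith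
    have key : ∃ m n : ℤ, s = 2 * m ∧ t = 2 * n := by
      refine ⟨s / 2, t / 2, ?_⟩
      interval_cases s <;> interval_cases t <;> omega
    obtain ⟨m, n, rfl, rfl⟩ := key
    refine mem_ringO_one.2 ⟨m, n, ?_, ?_⟩ <;> push_cast at hs ht ⊢ <;>
      simp only [Complex.conj_re, Complex.conj_im] <;> linarith
  · obtain ⟨s, hs⟩ := h 1 (one_mem _)
    obtain ⟨t, ht⟩ := h (Real.sqrt 2 * Complex.I) (mem_ringO_two.2 ⟨0, 1, by simp, by simp⟩)
    simp at hs ht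
    have e : 8 * Complex.normSq β = 2 * s * s + t * t := by
      rw [Complex.normSq_apply, ← hs, ← ht]
      linear_combination (-4 * β.im ^ 2) * h2
    have him : β.im = - t * Real.sqrt 2 / 4 := by
      rw [← ht]; linear_combination (-β.im / 2) * h2
    rcases hβ with hβ | ⟨-, hβ⟩
    · have e : 2 * s * s + t * t = 8 := by
        rw [hβ] at e; exact_mod_cast (by linarith : (2 * s * s + t * t : ℝ) = 8)
      have hs2 : s ≤ 2 := by nlinarith
      have hs2' : -2 ≤ s := by nlinarith
      have ht2 : t ≤ 3 := by nlinarith [mul_self_nonneg s]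
      have ht2' : -3 ≤ t := by nlinarith [mul_self_nonneg s]
      have key : ∃ m n : ℤ, s = 2 * m ∧ t = 4 * n := by
        interval_cases s <;> interval_cases t <;>
          first | omega | exact ⟨1, 0, by omega, by omega⟩ | exact ⟨-1, 0, by omega, by omega⟩
      obtain ⟨m, n, rfl, rfl⟩ := key
      rw [inv_eq_conj_of_normSq_eq_one hβ]
      refine mem_ringO_two.2 ⟨m, n, ?_, ?_⟩ <;> push_cast at hs him ⊢ <;>
        simp only [Complex.conj_re, Complex.conj_im] <;> linarith
    · have e : 2 * s * s + t * t = 4 := by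
        rw [hβ] at e; exact_mod_cast (by linarith : (2 * s * s + t * t : ℝ) = 4)
      have hs2 : s ≤ 1 := by nlinarith
      have hs2' : -1 ≤ s := by nlinarith
      have ht2 : t ≤ 2 := by nlinarith
      have ht2' : -2 ≤ t := by nlinarith
      have key : ∃ n : ℤ, t = 2 * n := by
        interval_cases s <;> interval_cases t <;>
          first | omega | exact ⟨1, by omega⟩ | exact ⟨-1, by omega⟩
      obtain ⟨n, rfl⟩ := key
      rw [Complex.inv_def, hβ]
      push_cast at him
      refine mem_ringO_two.2 ⟨s, n, ?_, ?_⟩ <;>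
      simp only [Complex.re_mul_ofReal, Complex.im_mul_ofReal, Complex.conj_re,
        Complex.conj_im] <;> norm_num <;> linarith
  · have hβ : Complex.normSq β = 1 := by simpa using hβ
    obtain ⟨s, hs⟩ := h 1 (one_mem _)
    obtain ⟨t, ht⟩ := h ⟨1 / 2, Real.sqrt 3 / 2⟩
      (mem_ringO_three.2 ⟨0, 1, by simp, by simp⟩)
    simp at hs ht
    rw [inv_eq_conj_of_normSq_eq_one hβ]
    rw [Complex.normSq_apply] at hβ
    have e : s * s - s * t + t * t = 3 := by
      have : (s : ℝ) * s - s * t + t * t = 3 := by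
        rw [← hs, ← ht]; linear_combination 3 * hβ + (β.im ^ 2) * h3
      exact_mod_cast this
    have him : β.im = (s / 2 - t) * Real.sqrt 3 / 3 := by
      rw [← hs, ← ht]; linear_combination (-β.im / 3) * h3
    have hs2 : s ≤ 2 := by nlinarith [sq_nonneg (s - 2 * t)]
    have hs2' : -2 ≤ s := by nlinarith [sq_nonneg (s - 2 * t)]
    have ht2 : t ≤ 2 := by nlinarith [sq_nonneg (t - 2 * s)]
    have ht2' : -2 ≤ t := by nlinarith [sq_nonneg (t - 2 * s)]
    have key : ∃ m n : ℤ, s = 2 * m + n ∧ t = m + 2 * n := by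
      -- Here `n = (2t - s)/3`, and `m = (s - n)/2` is written as `(s - n) - (s - n)/2`.
      refine ⟨s - (2 * t - s) / 3 - (s - (2 * t - s) / 3) / 2, (2 * t - s) / 3, ?_⟩
      interval_cases s <;> interval_cases t <;> omega
    obtain ⟨m, n, rfl, rfl⟩ := key
    refine mem_ringO_three.2 ⟨m, n, ?_, ?_⟩ <;> push_cast at hs him ⊢ <;>
      simp only [Complex.conj_re, Complex.conj_im] <;> linarith

theorem re_eq_zero_of_normSq_eq_two {g : ℂ} (hg : g ∈ ringO 2) (h : Complex.normSq g = 2) :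
    g.re = 0 ∧ ∃ n : ℤ, g.im = n * Real.sqrt 2 ∧ (n = 1 ∨ n = -1) := by
  have h2 : Real.sqrt 2 ^ 2 = 2 := Real.sq_sqrt (by norm_num)
  obtain ⟨m, n, hm, hn⟩ := mem_ringO_two.1 hg
  rw [Complex.normSq_apply, hm, hn] at h
  have e : m * m + 2 * n * n = 2 := by
    have : (m * m + 2 * n * n : ℝ) = 2 := by linear_combination h - (n : ℝ) ^ 2 * h2
    exact_mod_cast this
  have hn1 : n ≤ 1 := by nlinarith [mul_self_nonneg m]
  have hn2 : -1 ≤ n := by nlinarith [mul_self_nonneg m]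
  have hm1 : m ≤ 1 := by nlinarith [mul_self_nonneg n]
  have hm2 : -1 ≤ m := by nlinarith [mul_self_nonneg n]
  have key : m = 0 ∧ (n = 1 ∨ n = -1) := by
    interval_cases m <;> interval_cases n <;> omega
  exact ⟨by rw [hm, key.1]; simp, n, hn, key.2⟩

theorem isDual_inv_of_mem_mirrorVec {d : ℕ} (hd : d = 1 ∨ d = 2 ∨ d = 3) {g : ℂ}
    (hg : g ∈ mirrorVec d) : IsDual d g⁻¹ := by
  rcases hg.2 with h | ⟨rfl, h⟩
  · rw [inv_eq_conj_of_normSq_eq_one h]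
    exact isDual_of_mem_ringO hd (conj_mem_ringO hd hg.1)
  · have h2 : Real.sqrt 2 ^ 2 = 2 := Real.sq_sqrt (by norm_num)
    obtain ⟨hre, n, him, -⟩ := re_eq_zero_of_normSq_eq_two hg.1 h
    intro w hw
    obtain ⟨a, b, -, hb⟩ := mem_ringO_two.1 hw
    refine ⟨2 * n * b, ?_⟩
    rw [Complex.mul_re, Complex.inv_re, Complex.inv_im, h, hre, him, hb]
    push_cast
    linear_combination (n * b : ℝ) * h2

/-- This unit, `g²` or `-1`, is up to sign the linear part of the reflection in the bisector of `0`
and `g`; hence the reflection preserves the lattice. -/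
theorem div_conj_mem_ringO {d : ℕ} (hd : d = 1 ∨ d = 2 ∨ d = 3) {g : ℂ}
    (hg : g ∈ mirrorVec d) : g / conj g ∈ ringO d := by
  rcases hg.2 with h | ⟨rfl, h⟩
  · rw [← inv_eq_conj_of_normSq_eq_one h, div_inv_eq_mul]
    exact mul_mem hg.1 hg.1
  · obtain ⟨hre, -⟩ := re_eq_zero_of_normSq_eq_two hg.1 h
    have e : conj g = -g := by
      apply Complex.ext <;> simp [hre]
    rw [e, div_neg, div_self (ne_zero_of_mem_mirrorVec hg)]
    exact neg_mem (one_mem _)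

theorem normSq_div_conj {g : ℂ} (hg : g ≠ 0) : Complex.normSq (g / conj g) = 1 := by
  rw [Complex.normSq_div, Complex.normSq_conj, div_self (by simpa using hg)]

theorem neg_mem_mirrorVec {d : ℕ} {g : ℂ} (hg : g ∈ mirrorVec d) : -g ∈ mirrorVec d :=
  ⟨neg_mem hg.1, by rw [Complex.normSq_neg]; exact hg.2⟩

theorem abs_re_div_le {d : ℕ} {z g : ℂ} (hz : z ∈ closedU d) (hg : g ∈ mirrorVec d) :
    |2 * (z / g).re| ≤ 1 := by
  have h1 := hz g hg
  have h2 := hz _ (neg_mem_mirrorVec hg)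
  rw [div_neg, Complex.neg_re] at h2
  rw [abs_le]; constructor <;> linarith

/-! ### Explicit inequalities for the closed cell -/

theorem two_mul_div_re {z g : ℂ} :
    2 * (z / g).re = 2 * (z.re * g.re + z.im * g.im) / Complex.normSq g := by
  rw [Complex.div_re]; ring

theorem mem_closedU_one {z : ℂ} : z ∈ closedU 1 ↔ |2 * z.re| ≤ 1 ∧ |2 * z.im| ≤ 1 := by
  constructor
  · intro h
    have h1 := abs_re_div_le (g := 1) h ⟨one_mem _, by simp⟩
    have h2 := abs_re_div_le (g := Complex.I) h
      ⟨mem_ringO_one.2 ⟨0, 1, by simp, by simp⟩, by simp⟩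
    rw [two_mul_div_re] at h1 h2
    exact ⟨by simpa using h1, by simpa using h2⟩
  · rintro ⟨h1, h2⟩ g ⟨hg, hn⟩
    have hn : Complex.normSq g = 1 := by simpa using hn
    obtain ⟨m, n, hm, hn'⟩ := mem_ringO_one.1 hg
    rw [two_mul_div_re, hn, hm, hn']
    rw [Complex.normSq_apply, hm, hn'] at hn
    have e : m * m + n * n = 1 := by exact_mod_cast hn
    have hn1 : n ≤ 1 := by nlinarith [mul_self_nonneg m]
    have hn2 : -1 ≤ n := by nlinarith [mul_self_nonneg m]
    have hm1 : m ≤ 1 := by nlinarith [mul_self_nonneg n]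
    have hm2 : -1 ≤ m := by nlinarith [mul_self_nonneg n]
    rw [abs_le] at h1 h2
    have key : (m = 0 ∧ (n = 1 ∨ n = -1)) ∨ (n = 0 ∧ (m = 1 ∨ m = -1)) := by
      interval_cases m <;> interval_cases n <;> omega
    rcases key with ⟨rfl, rfl | rfl⟩ | ⟨rfl, rfl | rfl⟩ <;> push_cast <;> linarith

theorem mem_closedU_two {z : ℂ} :
    z ∈ closedU 2 ↔ |2 * z.re| ≤ 1 ∧ |Real.sqrt 2 * z.im| ≤ 1 := by
  have hs : Real.sqrt 2 * Real.sqrt 2 = 2 := Real.mul_self_sqrt (by norm_num)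
  constructor
  · intro h
    have h1 := abs_re_div_le (g := 1) h ⟨one_mem _, by simp⟩
    have h2 := abs_re_div_le (g := ⟨0, Real.sqrt 2⟩) h
      ⟨mem_ringO_two.2 ⟨0, 1, by simp, by simp⟩, Or.inr ⟨rfl, by simp [Complex.normSq_apply]⟩⟩
    rw [two_mul_div_re] at h1 h2
    refine ⟨by simpa using h1, ?_⟩
    convert h2 using 2
    simp only [Complex.normSq_apply, mul_zero, zero_add, hs]
    ring
  · rintro ⟨h1, h2⟩ g ⟨hg, hn⟩
    rw [abs_le] at h1 h2
    rcases hn with hn | ⟨-, hn⟩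
    · obtain ⟨m, n, hm, hn'⟩ := mem_ringO_two.1 hg
      rw [two_mul_div_re, hn, hm, hn']
      rw [Complex.normSq_apply, hm, hn'] at hn
      have e : m * m + 2 * (n * n) = 1 := by
        have : (m * m + 2 * (n * n) : ℝ) = 1 := by
          linear_combination hn - (n : ℝ) ^ 2 * hs
        exact_mod_cast this
      have hn1 : n ≤ 1 := by nlinarith [mul_self_nonneg m]
      have hn2 : -1 ≤ n := by nlinarith [mul_self_nonneg m]
      have hm1 : m ≤ 1 := by nlinarith [mul_self_nonneg n]
      have hm2 : -1 ≤ m := by nlinarith [mul_self_nonneg n]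
      have key : n = 0 ∧ (m = 1 ∨ m = -1) := by
        interval_cases m <;> interval_cases n <;> omega
      rcases key with ⟨rfl, rfl | rfl⟩ <;> push_cast <;> linarith
    · obtain ⟨hre, n, him, hn1⟩ := re_eq_zero_of_normSq_eq_two hg hn
      rw [two_mul_div_re, hn, hre, him]
      rcases hn1 with rfl | rfl <;> push_cast <;> linarith

theorem mem_closedU_three {z : ℂ} :
    z ∈ closedU 3 ↔ |2 * z.re| ≤ 1 ∧ |z.re + Real.sqrt 3 * z.im| ≤ 1 ∧
      |-z.re + Real.sqrt 3 * z.im| ≤ 1 := by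
  have hs : Real.sqrt 3 * Real.sqrt 3 = 3 := Real.mul_self_sqrt (by norm_num)
  constructor
  · intro h
    have h1 := abs_re_div_le (g := 1) h ⟨one_mem _, by simp⟩
    have h2 := abs_re_div_le (g := ⟨1 / 2, Real.sqrt 3 / 2⟩) h
      ⟨mem_ringO_three.2 ⟨0, 1, by simp, by simp⟩,
        Or.inl (by rw [Complex.normSq_apply]; linear_combination hs / 4)⟩
    have h3 := abs_re_div_le (g := ⟨-1 / 2, Real.sqrt 3 / 2⟩) h
      ⟨mem_ringO_three.2 ⟨-1, 1, by norm_num, by simp⟩,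
        Or.inl (by rw [Complex.normSq_apply]; linear_combination hs / 4)⟩
    rw [two_mul_div_re] at h1 h2 h3
    have e : (1 / 2 * (1 / 2) + Real.sqrt 3 / 2 * (Real.sqrt 3 / 2) : ℝ) = 1 := by
      linear_combination hs / 4
    have e' : (-1 / 2 * (-1 / 2) + Real.sqrt 3 / 2 * (Real.sqrt 3 / 2) : ℝ) = 1 := by
      linear_combination hs / 4
    simp only [Complex.normSq_apply, e, e'] at h2 h3
    refine ⟨by simpa using h1, ?_, ?_⟩
    · convert h2 using 2; ring
    · convert h3 using 2; ring
  · rintro ⟨h1, h2, h3⟩ g ⟨hg, hn⟩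
    have hn : Complex.normSq g = 1 := by simpa using hn
    obtain ⟨m, n, hm, hn'⟩ := mem_ringO_three.1 hg
    rw [two_mul_div_re, hn, hm, hn']
    rw [Complex.normSq_apply, hm, hn'] at hn
    have e : m * m + m * n + n * n = 1 := by
      have : (m * m + m * n + n * n : ℝ) = 1 := by
        linear_combination hn - (n : ℝ) ^ 2 / 4 * hs
      exact_mod_cast this
    have hn1 : n ≤ 1 := by nlinarith [mul_self_nonneg (2 * m + n)]
    have hn2 : -1 ≤ n := by nlinarith [mul_self_nonneg (2 * m + n)]
    have hm1 : m ≤ 1 := by nlinarith [mul_self_nonneg (2 * n + m)]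
    have hm2 : -1 ≤ m := by nlinarith [mul_self_nonneg (2 * n + m)]
    rw [abs_le] at h1 h2 h3
    have key : (m = 0 ∧ (n = 1 ∨ n = -1)) ∨ (n = 0 ∧ (m = 1 ∨ m = -1)) ∨
        (m = 1 ∧ n = -1) ∨ (m = -1 ∧ n = 1) := by
      interval_cases m <;> interval_cases n <;> omega
    rcases key with ⟨rfl, rfl | rfl⟩ | ⟨rfl, rfl | rfl⟩ | ⟨rfl, rfl⟩ | ⟨rfl, rfl⟩ <;>
      push_cast <;> linarith

theorem domainU_subset_closedU {d : ℕ} (hd : d = 1 ∨ d = 2 ∨ d = 3) :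
    domainU d ⊆ closedU d := by
  intro z hz
  have hs : Real.sqrt 2 * Real.sqrt 2 = 2 := Real.mul_self_sqrt (by norm_num)
  have hs0 : 0 ≤ Real.sqrt 2 := Real.sqrt_nonneg 2
  rcases hd with rfl | rfl | rfl
  · obtain ⟨⟨h1, h2⟩, h3, h4⟩ := hz
    rw [mem_closedU_one, abs_le, abs_le]
    refine ⟨⟨?_, ?_⟩, ?_, ?_⟩ <;> linarith
  · obtain ⟨⟨h1, h2⟩, h3, h4⟩ := hz
    rw [mem_closedU_two, abs_le, abs_le]
    refine ⟨⟨?_, ?_⟩, ?_, ?_⟩ <;> nlinarith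
  · obtain ⟨⟨h1, h2⟩, ⟨h3, h4⟩, h5, h6⟩ := hz
    rw [mem_closedU_three, abs_le, abs_le, abs_le]
    refine ⟨⟨?_, ?_⟩, ⟨?_, ?_⟩, ?_, ?_⟩ <;> linarith

/-- The value `3/4` is the squared circumradius for `d = 2`, the largest of the three cells. That it
is below `1` drives the descent, the convergence and the termination. -/
theorem normSq_le_of_mem_closedU {d : ℕ} (hd : d = 1 ∨ d = 2 ∨ d = 3) {z : ℂ}
    (hz : z ∈ closedU d) : Complex.normSq z ≤ 3 / 4 := by
  rw [Complex.normSq_apply]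
  rcases hd with rfl | rfl | rfl
  · obtain ⟨h1, h2⟩ := mem_closedU_one.1 hz
    rw [← sq_le_one_iff_abs_le_one] at h1 h2
    linarith
  · have hs : Real.sqrt 2 * Real.sqrt 2 = 2 := Real.mul_self_sqrt (by norm_num)
    obtain ⟨h1, h2⟩ := mem_closedU_two.1 hz
    rw [← sq_le_one_iff_abs_le_one] at h1 h2
    have : (Real.sqrt 2 * z.im) ^ 2 = 2 * (z.im * z.im) := by
      linear_combination (z.im ^ 2) * hs
    linarith
  · have hs : Real.sqrt 3 * Real.sqrt 3 = 3 := Real.mul_self_sqrt (by norm_num)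
    obtain ⟨h1, h2, h3⟩ := mem_closedU_three.1 hz
    rw [← sq_le_one_iff_abs_le_one] at h1 h2 h3
    have : (z.re + Real.sqrt 3 * z.im) ^ 2 + (-z.re + Real.sqrt 3 * z.im) ^ 2 =
        2 * (z.re * z.re) + 6 * (z.im * z.im) := by
      linear_combination (2 * z.im ^ 2) * hs
    linarith

theorem exists_mirrorVec_one_lt {d : ℕ} (hd : d = 1 ∨ d = 2 ∨ d = 3) {b : ℂ}
    (hb : b ∈ ringO d) (h0 : b ≠ 0) : ∃ g ∈ mirrorVec d, 1 < 2 * (b / g).re := by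
  by_contra! h
  have hb' : b ∈ closedU d := h
  have h1 := one_le_normSq hd hb h0
  have h2 := normSq_le_of_mem_closedU hd hb'
  linarith

/-! ### Translation of a point into the fundamental domain -/

theorem exists_sub_mem_domainU {d : ℕ} (hd : d = 1 ∨ d = 2 ∨ d = 3) (y : ℂ) :
    ∃ a ∈ ringO d, y - a ∈ domainU d := by
  rcases hd with rfl | rfl | rfl
  · refine ⟨⟨⌊y.re + 1 / 2⌋, ⌊y.im + 1 / 2⌋⟩, mem_ringO_one.2 ⟨_, _, rfl, rfl⟩, ?_⟩
    have h1 := Int.floor_le (y.re + 1 / 2)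
    have h2 := Int.lt_floor_add_one (y.re + 1 / 2)
    have h3 := Int.floor_le (y.im + 1 / 2)
    have h4 := Int.lt_floor_add_one (y.im + 1 / 2)
    refine ⟨⟨?_, ?_⟩, ?_, ?_⟩ <;> simp only [Complex.sub_re, Complex.sub_im] <;> linarith
  · have hs0 : 0 < Real.sqrt 2 := Real.sqrt_pos.2 (by norm_num)
    refine ⟨⟨⌊y.re + 1 / 2⌋, ⌊y.im / Real.sqrt 2 + 1 / 2⌋ * Real.sqrt 2⟩,
      mem_ringO_two.2 ⟨_, _, rfl, rfl⟩, ?_⟩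
    have h1 := Int.floor_le (y.re + 1 / 2)
    have h2 := Int.lt_floor_add_one (y.re + 1 / 2)
    have h3 := Int.floor_le (y.im / Real.sqrt 2 + 1 / 2)
    have h4 := Int.lt_floor_add_one (y.im / Real.sqrt 2 + 1 / 2)
    have e : y.im = y.im / Real.sqrt 2 * Real.sqrt 2 := by field_simp
    set t := y.im / Real.sqrt 2
    refine ⟨⟨?_, ?_⟩, ?_, ?_⟩ <;> simp only [Complex.sub_re, Complex.sub_im, e]
    · linarith
    · linarith
    · nlinarith
    · nlinarith
  · have hs : Real.sqrt 3 * Real.sqrt 3 = 3 := Real.mul_self_sqrt (by norm_num)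
    -- Coordinates `y = A + B ω`: doubled, the three hexagon conditions become integral linear forms
    -- in them.
    obtain ⟨A, B, hA, hB⟩ : ∃ A B : ℝ, y.re = A + B / 2 ∧ y.im = B * (Real.sqrt 3 / 2) :=
      ⟨y.re - y.im * Real.sqrt 3 / 3, 2 * (y.im * Real.sqrt 3 / 3), by ring,
        by linear_combination (-y.im / 3) * hs⟩
    suffices h : ∃ m n : ℤ, 2 * (A - m) + (B - n) ∈ Set.Ico (-1 : ℝ) 1 ∧
        (A - m) + 2 * (B - n) ∈ Set.Ico (-1 : ℝ) 1 ∧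
        (B - n) - (A - m) ∈ Set.Ico (-1 : ℝ) 1 by
      obtain ⟨m, n, h1, h2, h3⟩ := h
      refine ⟨⟨m + n / 2, n * (Real.sqrt 3 / 2)⟩, mem_ringO_three.2 ⟨_, _, rfl, rfl⟩, ?_⟩
      have e1 : (y - ⟨m + n / 2, n * (Real.sqrt 3 / 2)⟩).re = (2 * (A - m) + (B - n)) / 2 := by
        rw [Complex.sub_re, hA]; ring
      have e2 : Real.sqrt 3 / 2 * (y - ⟨m + n / 2, n * (Real.sqrt 3 / 2)⟩).im =
          3 * (B - n) / 4 := by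
        rw [Complex.sub_im, hB]; linear_combination ((B - n) / 4) * hs
      obtain ⟨h1, h1'⟩ := h1
      obtain ⟨h2, h2'⟩ := h2
      obtain ⟨h3, h3'⟩ := h3
      refine ⟨⟨?_, ?_⟩, ⟨?_, ?_⟩, ?_, ?_⟩ <;> (try rw [e2]) <;> rw [e1] <;> linarith
    have a1 := Int.floor_le A
    have a2 := Int.lt_floor_add_one A
    have b1 := Int.floor_le B
    have b2 := Int.lt_floor_add_one B
    set a : ℝ := A - ⌊A⌋ with ha
    set b : ℝ := B - ⌊B⌋ with hb
    have shift : ∀ m n : ℤ, 2 * (a - m) + (b - n) ∈ Set.Ico (-1 : ℝ) 1 →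
        (a - m) + 2 * (b - n) ∈ Set.Ico (-1 : ℝ) 1 →
        (b - n) - (a - m) ∈ Set.Ico (-1 : ℝ) 1 → _ := fun m n h1 h2 h3 =>
      (⟨⌊A⌋ + m, ⌊B⌋ + n, by push_cast; rwa [← sub_sub, ← sub_sub],
        by push_cast; rwa [← sub_sub, ← sub_sub], by push_cast; rwa [← sub_sub, ← sub_sub]⟩ :
        ∃ m n : ℤ, 2 * (A - m) + (B - n) ∈ Set.Ico (-1 : ℝ) 1 ∧
        (A - m) + 2 * (B - n) ∈ Set.Ico (-1 : ℝ) 1 ∧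
        (B - n) - (A - m) ∈ Set.Ico (-1 : ℝ) 1)
    -- The diagonal cuts the period parallelogram into two triangles, each of which is shared out
    -- among its three corners.
    rcases lt_or_ge b a with h | h
    · rcases lt_or_ge (a + 2 * b) 2 with h' | h'
      · rcases lt_or_ge (2 * a + b) 1 with h'' | h''
        · apply shift 0 0 <;> constructor <;> push_cast <;> linarith
        · apply shift 1 0 <;> constructor <;> push_cast <;> linarith
      · apply shift 1 1 <;> constructor <;> push_cast <;> linarith
    · rcases lt_or_ge (2 * a + b) 2 with h' | h'
      · rcases lt_or_ge (a + 2 * b) 1 with h'' | h''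
        · apply shift 0 0 <;> constructor <;> push_cast <;> linarith
        · apply shift 0 1 <;> constructor <;> push_cast <;> linarith
      · apply shift 1 1 <;> constructor <;> push_cast <;> linarith

theorem coeff_spec {d : ℕ} (hd : d = 1 ∨ d = 2 ∨ d = 3) (z : ℂ) :
    coeff d z ∈ ringO d ∧ 1 / z - coeff d z ∈ domainU d :=
  Classical.epsilon_spec (p := fun a : ℂ => a ∈ ringO d ∧ 1 / z - a ∈ domainU d)
    (exists_sub_mem_domainU hd (1 / z))

/-! ### Mirrors -/

/-- The Hermitian form `α |p|² + 2 Re (β p q̄) + γ |q|²`. -/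
def hermForm (α : ℝ) (β : ℂ) (γ : ℝ) (p q : ℂ) : ℝ :=
  α * Complex.normSq p + 2 * (β * p * conj q).re + γ * Complex.normSq q

/-- The sesquilinear form that polarizes `hermForm`. Its vanishing says that the points
`p / q` and `p' / q'` are swapped by the inversion in the circle `hermForm = 0`. -/
def polarForm (α : ℝ) (β : ℂ) (γ : ℝ) (p q p' q' : ℂ) : ℂ :=
  α * (p' * conj p) + β * p' * conj q + conj β * q' * conj p + γ * (q' * conj q)

theorem hermForm_mul (α : ℝ) (β : ℂ) (γ : ℝ) (p q w : ℂ) :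
    hermForm α β γ (p * w) (q * w) = Complex.normSq w * hermForm α β γ p q := by
  simp only [hermForm, Complex.normSq_apply, Complex.mul_re, Complex.mul_im, Complex.conj_re,
    Complex.conj_im]
  ring

/-- The pullback of `hermForm` under `(p, q) ↦ (q, a q + p)`. -/
theorem hermForm_step (α : ℝ) (β : ℂ) (γ : ℝ) (a p q : ℂ) :
    hermForm γ (conj β + γ * conj a) (hermForm α β γ 1 a) p q =
      hermForm α β γ q (a * q + p) := by
  simp only [hermForm, Complex.normSq_apply, Complex.mul_re, Complex.mul_im, Complex.conj_re,
    Complex.conj_im, Complex.add_re, Complex.add_im, Complex.ofReal_re, Complex.ofReal_im,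
    Complex.one_re, Complex.one_im]
  ring

/-- Points that are mirror images stay so under the substitution `w = 1/(a + w')`, with the mirror
pulled back. -/
theorem polarForm_step (α : ℝ) (β : ℂ) (γ : ℝ) (a p q p' q' : ℂ) :
    polarForm γ (conj β + γ * conj a) (hermForm α β γ 1 a) p q p' q' =
      polarForm α β γ q (a * q + p) q' (a * q' + p') := by
  have e : ((hermForm α β γ 1 a : ℝ) : ℂ) = α + (β * conj a + conj β * a) + γ * (a * conj a) := by
    have h : ((2 * (β * conj a).re : ℝ) : ℂ) = β * conj a + conj β * a := by
      have := Complex.add_conj (β * conj a)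
      rw [map_mul, Complex.conj_conj] at this
      rw [this]
    rw [Complex.mul_conj]
    simp only [hermForm, mul_one, map_one]
    rw [Complex.ofReal_add, Complex.ofReal_add, h, Complex.ofReal_mul]
  simp only [polarForm, e, map_add, map_mul, Complex.conj_conj, Complex.conj_ofReal]
  ring

/-- The circles and lines fixed by the reflections that are conjugate to a reflection of
`ℂ` which swaps `0` with a Voronoi vector. -/
def IsMirror (d : ℕ) (α : ℤ) (β : ℂ) (γ : ℤ) : Prop :=
  IsDual d β ∧ (Complex.normSq β - α * γ = 1 ∨ d = 2 ∧ Complex.normSq β - α * γ = 1 / 2)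

theorem exists_hermForm_eq_intCast {d : ℕ} (hd : d = 1 ∨ d = 2 ∨ d = 3) {α γ : ℤ} {β a : ℂ}
    (h : IsMirror d α β γ) (ha : a ∈ ringO d) : ∃ n : ℤ, hermForm α β γ 1 a = n := by
  obtain ⟨m, hm⟩ := h.1 _ (conj_mem_ringO hd ha)
  obtain ⟨n, hn⟩ := exists_normSq_eq_intCast hd ha
  refine ⟨α + m + γ * n, ?_⟩
  rw [hermForm, hn, mul_one, hm]; simp

/-- The substitution has determinant of modulus `1`, so the discriminant `|β|² - αγ` is unchanged.
-/
theorem isMirror_step {d : ℕ} (hd : d = 1 ∨ d = 2 ∨ d = 3) {α γ n : ℤ} {β a : ℂ}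
    (h : IsMirror d α β γ) (ha : a ∈ ringO d) (hn : hermForm α β γ 1 a = n) :
    IsMirror d γ (conj β + γ * conj a) n := by
  refine ⟨isDual_add (isDual_conj hd h.1) (isDual_of_mem_ringO hd
    (mul_mem (intCast_mem _ γ) (conj_mem_ringO hd ha))), ?_⟩
  have e : Complex.normSq (conj β + γ * conj a) - γ * n = Complex.normSq β - α * γ := by
    rw [← hn]
    simp only [hermForm, Complex.normSq_apply, Complex.mul_re, Complex.mul_im, Complex.conj_re,
      Complex.conj_im, Complex.add_re, Complex.add_im, Complex.intCast_re, Complex.intCast_im,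
      Complex.one_re, Complex.one_im]
    ring
  rw [e]; exact h.2

/-- A mirror that separates `∞` from `0` is the unit circle. -/
theorem IsMirror.hermForm_neg {d : ℕ} (hd : d = 1 ∨ d = 2 ∨ d = 3) {α γ : ℤ} {β z : ℂ}
    (h : IsMirror d α β γ) (hα : 0 < α) (hγ : γ < 0) (hz : z ∈ closedU d) :
    hermForm α β γ z 1 < 0 := by
  have h1 : α * γ ≤ -1 := by nlinarith
  have h1' : (α * γ : ℝ) ≤ -1 := by exact_mod_cast h1
  have h0 := Complex.normSq_nonneg β
  -- The discriminant is at most `1` and `αγ ≤ -1`, which leaves no room for `β`.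
  have hle : Complex.normSq β ≤ 1 + α * γ := by
    rcases h.2 with h | ⟨-, h⟩ <;> linarith
  have hβ : β = 0 := Complex.normSq_eq_zero.1 (by linarith)
  have h2 : -1 ≤ α * γ := by
    have : (-1 : ℝ) ≤ α * γ := by linarith
    exact_mod_cast this
  have hα1 : α = 1 := by nlinarith
  have hγ1 : γ = -1 := by nlinarith
  have := normSq_le_of_mem_closedU hd hz
  simp only [hermForm, hα1, hγ1, hβ]
  simp
  linarith

/-! ### Convergents of nearest integer expansions with arbitrary choices at ties -/

/-- `IsNearConv d n z p q`: the fraction `p / q` is the `n`-th convergent of an expansion of `z`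
all of whose remainders lie in `closedU d`. -/
inductive IsNearConv (d : ℕ) : ℕ → ℂ → ℂ → ℂ → Prop
  | zero {z : ℂ} : z ∈ closedU d → IsNearConv d 0 z 0 1
  | succ {n : ℕ} {z a p q : ℂ} : z ∈ closedU d → z ≠ 0 → a ∈ ringO d →
      IsNearConv d n (1 / z - a) p q → IsNearConv d (n + 1) z q (a * q + p)

theorem IsNearConv.mem_closedU {d n : ℕ} {z p q : ℂ} (h : IsNearConv d n z p q) :
    z ∈ closedU d := by
  cases h <;> assumption

/-- Pairs of elements of `ℤ[ω_d]`, not both zero, as homogeneous coordinates. -/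
def IsVec (d : ℕ) (p q : ℂ) : Prop := p ∈ ringO d ∧ q ∈ ringO d ∧ (p ≠ 0 ∨ q ≠ 0)

theorem IsNearConv.isVec {d n : ℕ} {z p q : ℂ} (h : IsNearConv d n z p q) : IsVec d p q := by
  induction h with
  | zero _ => exact ⟨zero_mem _, one_mem _, Or.inr one_ne_zero⟩
  | @succ n z a p q _ _ ha _ ih =>
    obtain ⟨hp, hq, h0⟩ := ih
    refine ⟨hq, add_mem (mul_mem ha hq) hp, ?_⟩
    by_cases hq0 : q = 0
    · right
      rcases h0 with h0 | h0
      · simpa [hq0] using h0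
      · exact absurd hq0 h0
    · exact Or.inl hq0

/-- The coefficients of `u z̄` are alternately `ū ā` and `u ā`. The pair of numerator and
denominator picks up a common factor on the way, hence `c`. -/
theorem IsNearConv.mul_conj {d : ℕ} (hd : d = 1 ∨ d = 2 ∨ d = 3) {n : ℕ} {z p q : ℂ}
    (h : IsNearConv d n z p q) : ∀ u ∈ ringO d, Complex.normSq u = 1 →
      ∃ c : ℂ, IsNearConv d n (u * conj z) (c * (u * conj p)) (c * conj q) := by
  induction h with
  | zero hz =>
    intro u hu hu1
    refine ⟨1, ?_⟩
    simpa using IsNearConv.zero (mul_conj_mem_closedU hd hz hu hu1)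
  | @succ n z a p q hz hz0 ha _ ih =>
    intro u hu hu1
    have hu0 : u ≠ 0 := by rintro rfl; simp at hu1
    have hcu : conj u = 1 / u := by rw [← inv_eq_conj_of_normSq_eq_one hu1, one_div]
    have hcz0 : conj z ≠ 0 := by simpa using hz0
    obtain ⟨c, hc⟩ := ih (conj u) (conj_mem_ringO hd hu) (by rw [Complex.normSq_conj, hu1])
    refine ⟨c * conj u, ?_⟩
    have e : conj u * conj (1 / z - a) = 1 / (u * conj z) - conj u * conj a := by
      simp only [map_sub, map_div₀, map_one]
      rw [hcu]; field_simp
    rw [e] at hc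
    have := IsNearConv.succ (mul_conj_mem_closedU hd hz hu hu1) (mul_ne_zero hu0 hcz0)
      (mul_mem (conj_mem_ringO hd hu) (conj_mem_ringO hd ha)) hc
    convert this using 1
    · rw [hcu]; field_simp
    · simp only [map_add, map_mul]; ring

/-- If a convergent of `z` lies strictly beyond a mirror that does not separate `∞`, `0` and `z`,
then `z` is on the mirror, and the reflected point is also a convergent of `z`. -/
theorem IsNearConv.reflect {d : ℕ} (hd : d = 1 ∨ d = 2 ∨ d = 3) {n : ℕ} {z p q : ℂ}
    (h : IsNearConv d n z p q) : ∀ (α γ : ℤ) (β : ℂ), IsMirror d α β γ → 0 ≤ α → 0 ≤ γ →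
      0 ≤ hermForm α β γ z 1 → 0 ≤ hermForm α β γ p q ∨
      ∃ p' q', IsNearConv d n z p' q' ∧ polarForm α β γ p q p' q' = 0 := by
  induction h with
  | zero hz =>
    intro α γ β _ _ hγ _
    left
    simpa [hermForm] using hγ
  | @succ n z a p q hz hz0 ha hG ih =>
    intro α γ β hM hα hγ hzM
    -- The integer `n'` is the value at `0` of the form pulled back to the next remainder.
    obtain ⟨n', hn'⟩ := exists_hermForm_eq_intCast hd hM ha
    have hM' := isMirror_step hd hM ha hn'
    have step := hermForm_step α β γ a
    have pstep := polarForm_step α β γ a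
    rw [hn'] at step pstep
    push_cast at pstep
    have hz' : 0 ≤ hermForm γ (conj β + γ * conj a) n' (1 / z - a) 1 := by
      have e : hermForm α β γ 1 (a * 1 + (1 / z - a)) =
          Complex.normSq (1 / z) * hermForm α β γ z 1 := by
        rw [← hermForm_mul]
        congr 1
        · field_simp
        · ring
      have e' := step (1 / z - a) 1
      push_cast at e'
      rw [e', e]
      exact mul_nonneg (Complex.normSq_nonneg _) hzM
    rcases le_or_gt 0 n' with hn0 | hn0
    · rcases ih γ n' _ hM' hγ hn0 hz' with h | ⟨p', q', hG', hp⟩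
      · left
        have e' := step p q
        push_cast at e'
        rwa [e'] at h
      · right
        refine ⟨q', a * q' + p', .succ hz hz0 ha hG', ?_⟩
        rw [← pstep]; exact hp
    -- If `γ > 0`, the pulled-back mirror separates `∞` from `0`, and the remainder would lie
    -- strictly on the side of `0`. If `γ = 0`, the mirror is a line.
    · rcases hγ.lt_or_eq with hγ | hγ
      · exact absurd hz' (not_le.2 (hM'.hermForm_neg hd hγ hn0 hG.mem_closedU))
      subst hγ
      set β' := conj β + ((0 : ℤ) : ℂ) * conj a
      have hβ1 : Complex.normSq β' = 1 ∨ d = 2 ∧ Complex.normSq β' = 1 / 2 := by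
        simpa using hM'.2
      have hg := inv_mem_mirrorVec_of_isDual hd hM'.1 hβ1
      set g := β'⁻¹ with hgdef
      have hg0 := ne_zero_of_mem_mirrorVec hg
      have hcg0 : conj g ≠ 0 := by simpa using hg0
      have hβg : β' = 1 / g := by rw [hgdef]; simp
      set z' := 1 / z - a with hz'def
      have h1 := hG.mem_closedU g hg
      have h2 : hermForm (0 : ℤ) β' n' z' 1 = 2 * (z' / g).re + n' := by
        simp [hermForm, hβg, div_eq_inv_mul]
      rw [h2] at hz'
      -- The cell condition `2 Re (z'/g) ≤ 1` forces the line to be the bisector of `0` and `g`,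
      -- with the remainder on it.
      have hn1 : n' = -1 := by
        have : (-1 : ℝ) ≤ n' := by linarith
        have : -1 ≤ n' := by exact_mod_cast this
        omega
      subst hn1
      have h3 : 2 * (z' / g).re = 1 := by push_cast at hz'; linarith
      have h4 : z' / g + conj z' / conj g = 1 := by
        rw [← map_div₀, Complex.add_conj, h3]; simp
      -- The reflection fixes `z'`, so the coefficient `a + g` gives a remainder that is a unit
      -- times `z̄'`, again in the cell.
      have h5 : 1 / z - (a + g) = -(g / conj g) * conj z' := by
        have : z' = g - g / conj g * conj z' := by
          field_simp at h4 ⊢; linear_combination h4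
        rw [← sub_sub, ← hz'def]
        linear_combination this
      obtain ⟨c, hc⟩ := hG.mul_conj hd (-(g / conj g)) (neg_mem (div_conj_mem_ringO hd hg))
        (by rw [Complex.normSq_neg, normSq_div_conj hg0])
      rw [← h5] at hc
      right
      refine ⟨_, _, .succ hz hz0 (add_mem ha hg.1) hc, ?_⟩
      have e : (a + g) * (c * conj q) + c * (-(g / conj g) * conj p) =
        a * (c * conj q) + (g * (c * conj q) + c * (-(g / conj g) * conj p)) := by ring
      rw [e, ← pstep]
      simp only [polarForm, hβg, map_div₀, map_one]
      push_cast
      field_simp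
      ring

/-! ### Chains of points -/

/-- A chain of `m` steps from `p / q` to `x / y`, in homogeneous coordinates, where each step
goes to an adjacent vertex or stays at the same point. -/
def Chain (d : ℕ) : ℕ → ℂ → ℂ → ℂ → ℂ → Prop
  | 0, p, q, x, y => p * y - q * x = 0
  | m + 1, p, q, x, y => ∃ r s, IsVec d r s ∧ Complex.normSq (p * s - q * r) ≤ 1 ∧
      Chain d m r s x y

/-- The map `w ↦ 1/w - a` changes determinants only by a sign. -/
theorem Chain.step {d : ℕ} {a : ℂ} (ha : a ∈ ringO d) : ∀ {m : ℕ} {p q x y : ℂ},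
    Chain d m p q x y → Chain d m (q - a * p) p (y - a * x) x
  | 0, p, q, x, y, h => by
    change _ = _ at h
    change _ = _
    linear_combination -h
  | m + 1, p, q, x, y, ⟨r, s, ⟨hr, hs, h0⟩, hn, h⟩ => by
    refine ⟨s - a * r, r, ⟨sub_mem hs (mul_mem ha hr), hr, ?_⟩, ?_, h.step ha⟩
    · by_cases hr0 : r = 0
      · left
        rcases h0 with h0 | h0
        · exact absurd hr0 h0
        · simpa [hr0] using h0
      · exact Or.inr hr0
    · rw [← Complex.normSq_neg]
      convert hn using 2
      ring

theorem Chain.congr_right {d : ℕ} {x y x' y' : ℂ} (h0 : x ≠ 0 ∨ y ≠ 0)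
    (hx : x * y' - y * x' = 0) : ∀ {m : ℕ} {p q : ℂ}, Chain d m p q x y → Chain d m p q x' y'
  | 0, p, q, h => by
    change _ = _ at h
    change _ = _
    rcases h0 with h0 | h0
    · refine (mul_eq_zero.1 (?_ : x * (p * y' - q * x') = 0)).resolve_left h0
      linear_combination p * hx + x' * h
    · refine (mul_eq_zero.1 (?_ : y * (p * y' - q * x') = 0)).resolve_left h0
      linear_combination q * hx + y' * h
  | m + 1, p, q, ⟨r, s, hv, hn, h⟩ => ⟨r, s, hv, hn, h.congr_right h0 hx⟩

/-! ### Reflection and folding of chains -/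

/-- The numerator of the reflection of `p / q` in the perpendicular bisector of `0` and `g`;
the denominator is `q̄`. -/
noncomputable def reflNum (g p q : ℂ) : ℂ := g * conj q - g / conj g * conj p

/-- The value of the form of the perpendicular bisector of `0` and `g`. -/
noncomputable abbrev bisector (g p q : ℂ) : ℝ := hermForm (0 : ℤ) (-g⁻¹) (1 : ℤ) p q

theorem det_reflNum {g : ℂ} (hg : g ≠ 0) (p q r s : ℂ) :
    p * conj s - q * reflNum g r s = -g * polarForm (0 : ℤ) (-g⁻¹) (1 : ℤ) r s p q := by
  have hcg0 : conj g ≠ 0 := by simpa using hg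
  simp only [reflNum, polarForm, map_neg, map_inv₀]
  push_cast
  field_simp
  ring

theorem normSq_polarForm (k p q r s : ℂ) :
    Complex.normSq (polarForm (0 : ℤ) k (1 : ℤ) p q r s) =
      Complex.normSq k * Complex.normSq (p * s - q * r) +
        hermForm (0 : ℤ) k (1 : ℤ) p q * hermForm (0 : ℤ) k (1 : ℤ) r s := by
  simp only [polarForm, hermForm, Complex.normSq_apply, Complex.mul_re, Complex.mul_im,
    Complex.conj_re, Complex.conj_im, Complex.add_re, Complex.add_im, Complex.sub_re,
    Complex.sub_im, Complex.ofReal_re, Complex.ofReal_im]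
  push_cast
  ring

/-- The inequality behind folding: for points on opposite sides of the mirror the last product is
nonpositive, so reflecting one of them cannot increase the determinant. -/
theorem normSq_det_reflNum {g : ℂ} (hg : g ≠ 0) (p q r s : ℂ) :
    Complex.normSq (p * conj s - q * reflNum g r s) =
      Complex.normSq (p * s - q * r) +
        Complex.normSq g * (bisector g p q * bisector g r s) := by
  have hg' : Complex.normSq g ≠ 0 := by simpa using hg
  rw [det_reflNum hg, Complex.normSq_mul, normSq_polarForm, Complex.normSq_neg,
    Complex.normSq_neg, Complex.normSq_inv,
    show r * q - s * p = -(p * s - q * r) by ring, Complex.normSq_neg, bisector, bisector]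
  field_simp

theorem normSq_det_reflNum_reflNum {g : ℂ} (hg : g ≠ 0) (p q r s : ℂ) :
    Complex.normSq (reflNum g p q * conj s - conj q * reflNum g r s) =
      Complex.normSq (p * s - q * r) := by
  have e : reflNum g p q * conj s - conj q * reflNum g r s =
      -(g / conj g) * conj (p * s - q * r) := by
    simp only [reflNum, map_sub, map_mul]; ring
  rw [e, Complex.normSq_mul, Complex.normSq_neg, normSq_div_conj hg, Complex.normSq_conj,
    one_mul]

theorem normSq_reflNum {g : ℂ} (hg : g ≠ 0) (p q : ℂ) :
    Complex.normSq (reflNum g p q) =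
      Complex.normSq p + Complex.normSq g * bisector g p q := by
  have h := normSq_det_reflNum hg 0 1 p q
  simp only [zero_mul, zero_sub, one_mul, Complex.normSq_neg] at h
  rw [h]
  simp [bisector, hermForm]

theorem isVec_reflNum {d : ℕ} (hd : d = 1 ∨ d = 2 ∨ d = 3) {g p q : ℂ} (hg : g ∈ mirrorVec d)
    (h : IsVec d p q) : IsVec d (reflNum g p q) (conj q) := by
  have hg0 := ne_zero_of_mem_mirrorVec hg
  refine ⟨sub_mem (mul_mem hg.1 (conj_mem_ringO hd h.2.1))
    (mul_mem (div_conj_mem_ringO hd hg) (conj_mem_ringO hd h.1)),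
    conj_mem_ringO hd h.2.1, ?_⟩
  by_cases hq : q = 0
  · left
    have hp : p ≠ 0 := h.2.2.resolve_right (not_not.2 hq)
    simp [reflNum, hq, hp, hg0]
  · right; simpa using hq

theorem Chain.reflect {d : ℕ} (hd : d = 1 ∨ d = 2 ∨ d = 3) {g : ℂ} (hg : g ∈ mirrorVec d) :
    ∀ {m : ℕ} {p q x y : ℂ}, Chain d m p q x y →
      Chain d m (reflNum g p q) (conj q) (reflNum g x y) (conj y)
  | 0, p, q, x, y, h => by
    change _ = _ at h
    change _ = _
    rw [← Complex.normSq_eq_zero,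
      normSq_det_reflNum_reflNum (ne_zero_of_mem_mirrorVec hg), h, map_zero]
  | m + 1, p, q, x, y, ⟨r, s, hv, hn, h⟩ => by
    refine ⟨reflNum g r s, conj s, isVec_reflNum hd hg hv, ?_, h.reflect hd hg⟩
    rwa [normSq_det_reflNum_reflNum (ne_zero_of_mem_mirrorVec hg)]

/-- The part of a chain beyond a mirror can be folded back. -/
theorem Chain.fold {d : ℕ} (hd : d = 1 ∨ d = 2 ∨ d = 3) {g : ℂ} (hg : g ∈ mirrorVec d)
    {x y : ℂ} (hx : 0 ≤ bisector g x y) :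
    ∀ {m : ℕ} {p q : ℂ}, bisector g p q ≤ 0 → Chain d m p q x y →
      Chain d m (reflNum g p q) (conj q) x y
  | 0, p, q, hp, h => by
    change _ = _ at h
    change _ = _
    -- The two representatives give the same point, on both closed sides, so the reflection fixes
    -- it.
    have e := normSq_det_reflNum (ne_zero_of_mem_mirrorVec hg) x y p q
    have h' : x * q - y * p = 0 := by linear_combination -h
    rw [h', map_zero, zero_add] at e
    have h1 : x * conj q - y * reflNum g p q = 0 := by
      rw [← Complex.normSq_eq_zero]
      refine le_antisymm ?_ (Complex.normSq_nonneg _)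
      rw [e]
      exact mul_nonpos_of_nonneg_of_nonpos (Complex.normSq_nonneg _)
        (mul_nonpos_of_nonneg_of_nonpos hx hp)
    linear_combination -h1
  | m + 1, p, q, hp, ⟨r, s, hv, hn, h⟩ => by
    rcases le_total (bisector g r s) 0 with hr | hr
    · refine ⟨reflNum g r s, conj s, isVec_reflNum hd hg hv, ?_, h.fold hd hg hx hr⟩
      rwa [normSq_det_reflNum_reflNum (ne_zero_of_mem_mirrorVec hg)]
    -- The chain crosses the mirror here, and the reflected start may coincide with `r / s`; this is
    -- why a step may stay in place.
    · refine ⟨r, s, hv, le_trans ?_ hn, h⟩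
      have e := normSq_det_reflNum (ne_zero_of_mem_mirrorVec hg) r s p q
      rw [← Complex.normSq_neg, show -(reflNum g p q * s - conj q * r) =
        r * conj q - s * reflNum g p q by ring, e,
        ← Complex.normSq_neg (r * q - s * p),
        show -(r * q - s * p) = p * s - q * r by ring]
      have := mul_nonpos_of_nonneg_of_nonpos (Complex.normSq_nonneg g)
        (mul_nonpos_of_nonneg_of_nonpos hr hp)
      linarith

/-! ### The distance from `∞` to a convergent -/

/-- On leaving `∞` the chain reaches a unit denominator: a product of two nonzero ring elements has
modulus at most `1` only if both have modulus `1`. -/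
theorem succ_le_of_chain_infty {d : ℕ} (hd : d = 1 ∨ d = 2 ∨ d = 3) {n : ℕ} {x y : ℂ}
    (hy : y ≠ 0)
    (h : ∀ (m : ℕ) (r s : ℂ), r ∈ ringO d → s ∈ ringO d → Complex.normSq s = 1 →
      Chain d m r s x y → n ≤ m) :
    ∀ (m : ℕ) (r : ℂ), r ∈ ringO d → r ≠ 0 → Chain d m r 0 x y → n + 1 ≤ m
  | 0, r, _, hr0, hc => by
    change _ = _ at hc
    simp [hr0, hy] at hc
  | m + 1, r, hr, hr0, ⟨r', s', ⟨hr', hs', h0⟩, hn, hc⟩ => by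
    by_cases hs0 : s' = 0
    · subst hs0
      have := succ_le_of_chain_infty hd hy h m r' hr' (by simpa using h0) hc
      omega
    · have h1 := one_le_normSq hd hr hr0
      have h2 := one_le_normSq hd hs' hs0
      rw [zero_mul, sub_zero, Complex.normSq_mul] at hn
      have h3 : Complex.normSq s' = 1 := by nlinarith
      have := h m r' s' hr' hs' h3 hc
      omega

theorem isMirror_bisector {d : ℕ} (hd : d = 1 ∨ d = 2 ∨ d = 3) {g : ℂ}
    (hg : g ∈ mirrorVec d) : IsMirror d 0 (-g⁻¹) 1 := by
  refine ⟨fun w hw => ?_, ?_⟩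
  · obtain ⟨n, hn⟩ := isDual_inv_of_mem_mirrorVec hd hg w hw
    exact ⟨-n, by rw [neg_mul, Complex.neg_re]; push_cast; linarith⟩
  · rw [Complex.normSq_neg, Complex.normSq_inv]
    rcases hg.2 with h | ⟨h', h⟩ <;> rw [h]
    · left; norm_num
    · right; exact ⟨h', by norm_num⟩

theorem bisector_eq (g p q : ℂ) :
    bisector g p q = Complex.normSq q - 2 * (p * conj q / g).re := by
  have e : -g⁻¹ * p * conj q = -(p * conj q / g) := by ring
  simp only [bisector, hermForm, e, Complex.neg_re]
  push_cast; ring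

/-- Descent on the integer `|r|²`, bounded by `k`: as long as `r / s` is a nonzero lattice point, a
reflection moves it closer to `0`, for the same `z` but possibly another convergent. -/
theorem IsNearConv.le_of_chain {d : ℕ} (hd : d = 1 ∨ d = 2 ∨ d = 3) {n : ℕ} {z : ℂ}
    (base : ∀ p q : ℂ, IsNearConv d n z p q → ∀ (m : ℕ) (s : ℂ), s ∈ ringO d →
      Complex.normSq s = 1 → Chain d m 0 s p q → n ≤ m) (k : ℕ) :
    ∀ (p q : ℂ), IsNearConv d n z p q → ∀ (m : ℕ) (r s : ℂ), r ∈ ringO d → s ∈ ringO d →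
      Complex.normSq s = 1 → Complex.normSq r < k → Chain d m r s p q → n ≤ m := by
  induction k with
  | zero =>
    intro p q _ m r s _ _ _ hr
    have := Complex.normSq_nonneg r
    push_cast at hr; linarith
  | succ k ih =>
    intro p q hG m r s hr hs hs1 hk hc
    by_cases hr0 : r = 0
    · subst hr0
      exact base p q hG m s hs hs1 hc
    have hs0 : conj s ≠ 0 := by
      have : s ≠ 0 := by rintro rfl; simp at hs1
      simpa using this
    obtain ⟨g, hg, hlt⟩ := exists_mirrorVec_one_lt hd (mul_mem hr (conj_mem_ringO hd hs))
      (mul_ne_zero hr0 hs0)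
    have hg0 := ne_zero_of_mem_mirrorVec hg
    have hneg : bisector g r s < 0 := by rw [bisector_eq, hs1]; linarith
    have hvec := isVec_reflNum hd hg (p := r) (q := s) ⟨hr, hs, Or.inl hr0⟩
    have hk' : Complex.normSq (reflNum g r s) < k := by
      have hlt' : Complex.normSq (reflNum g r s) < Complex.normSq r := by
        rw [normSq_reflNum hg0]
        have := mul_neg_of_pos_of_neg (Complex.normSq_pos.2 hg0) hneg
        linarith
      obtain ⟨a, ha⟩ := exists_normSq_eq_intCast hd hr
      obtain ⟨b, hb⟩ := exists_normSq_eq_intCast hd hvec.1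
      rw [ha] at hlt' hk
      rw [hb] at hlt' ⊢
      have h1 : b < a := by exact_mod_cast hlt'
      have h2 : a < k + 1 := by exact_mod_cast hk
      have : b < k := by omega
      exact_mod_cast this
    have hs1' : Complex.normSq (conj s) = 1 := by rw [Complex.normSq_conj, hs1]
    rcases le_or_gt 0 (bisector g p q) with hx | hx
    · exact ih p q hG m _ _ hvec.1 hvec.2.1 hs1' hk' (hc.fold hd hg hx hneg.le)
    · have hz : 0 ≤ hermForm (0 : ℤ) (-g⁻¹) (1 : ℤ) z 1 := by
        have h1 := bisector_eq g z 1
        have h2 := hG.mem_closedU g hg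
        simp only [map_one, mul_one] at h1
        change 0 ≤ bisector g z 1
        rw [h1]; linarith
      -- Only the convergent is beyond the bisector, not `z`; its reflection is again a convergent,
      -- and the whole chain is reflected to end there.
      rcases hG.reflect hd 0 1 _ (isMirror_bisector hd hg) le_rfl zero_le_one hz with
        h | ⟨p', q', hG', hp⟩
      · exact absurd h (not_le.2 hx)
      · refine ih p' q' hG' m _ _ hvec.1 hvec.2.1 hs1' hk' ?_
        refine (hc.reflect hd hg).congr_right (isVec_reflNum hd hg hG.isVec).2.2 ?_
        have := det_reflNum hg0 p' q' p q
        rw [hp] at this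
        linear_combination -this

/-- The claims need each other: the bound at `n` gives `q ≠ 0` at `n + 1`, and `q ≠ 0` at `n` enters
the bound at `n + 1`. -/
theorem IsNearConv.den_ne_zero_and_le {d : ℕ} (hd : d = 1 ∨ d = 2 ∨ d = 3) (n : ℕ) :
    ∀ z p q : ℂ, IsNearConv d n z p q → q ≠ 0 ∧
      ∀ (m : ℕ) (r s : ℂ), r ∈ ringO d → s ∈ ringO d → Complex.normSq s = 1 →
        Chain d m r s p q → n ≤ m := by
  induction n with
  | zero =>
    intro z p q h
    cases h
    exact ⟨one_ne_zero, fun _ _ _ _ _ _ _ => Nat.zero_le _⟩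
  | succ n ih =>
    have base : ∀ z p q : ℂ, IsNearConv d (n + 1) z p q → q ≠ 0 ∧ ∀ (m : ℕ) (s : ℂ),
        s ∈ ringO d → Complex.normSq s = 1 → Chain d m 0 s p q → n + 1 ≤ m := by
      intro z p q h
      cases h with
      | @succ _ _ a p q hz hz0 ha hG =>
      obtain ⟨hq, hle⟩ := ih _ _ _ hG
      refine ⟨fun h0 => ?_, fun m s hs hs1 hc => ?_⟩
      -- A zero denominator puts the previous convergent at the lattice point `-a`, so `n = 0` and
      -- `a = 0`; then `z` and `1/z` would both lie in the cell.
      · have hn := hle 0 (-a) 1 (neg_mem ha) (one_mem _) (by simp)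
          (by change _ = _; linear_combination -h0)
        obtain rfl : n = 0 := by omega
        cases hG with
        | zero hz' =>
        obtain rfl : a = 0 := by simpa using h0
        have h1 := normSq_le_of_mem_closedU hd hz
        have h2 := normSq_le_of_mem_closedU hd hz'
        have h3 : Complex.normSq z * Complex.normSq (1 / z - 0) = 1 := by
          rw [← Complex.normSq_mul, sub_zero, mul_one_div_cancel hz0, map_one]
        nlinarith [Complex.normSq_nonneg z]
      -- Moves the start of the chain from `0` to `∞`.
      · have hc' := hc.step ha
        rw [mul_zero, sub_zero, add_sub_cancel_left] at hc'
        exact succ_le_of_chain_infty hd hq hle m s hs (by rintro rfl; simp at hs1) hc'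
    intro z p q h
    refine ⟨(base z p q h).1, fun m r s hr hs hs1 hc => ?_⟩
    obtain ⟨k, hk⟩ := exists_nat_gt (Complex.normSq r)
    exact IsNearConv.le_of_chain hd (fun p q hG => (base z p q hG).2) k p q h m r s hr hs hs1
      hk hc

theorem IsNearConv.den_ne_zero {d : ℕ} (hd : d = 1 ∨ d = 2 ∨ d = 3) {n : ℕ} {z p q : ℂ}
    (h : IsNearConv d n z p q) : q ≠ 0 :=
  (h.den_ne_zero_and_le hd n _ _ _).1

theorem IsNearConv.succ_le_of_chain {d : ℕ} (hd : d = 1 ∨ d = 2 ∨ d = 3) {n m : ℕ}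
    {z p q : ℂ} (h : IsNearConv d n z p q) (hc : Chain d m 1 0 p q) : n + 1 ≤ m :=
  succ_le_of_chain_infty hd (h.den_ne_zero hd) (h.den_ne_zero_and_le hd n _ _ _).2 m 1
    (one_mem _) one_ne_zero hc

/-! ### Convergents of `[0; a₁, a₂, …]` -/

/-- The numerator of `[0; a 0, …, a (n - 1)]`. -/
noncomputable def cNum (a : ℕ → ℂ) : ℕ → ℂ
  | 0 => 0
  | 1 => 1
  | n + 2 => a (n + 1) * cNum a (n + 1) + cNum a n

/-- The denominator of `[0; a 0, …, a (n - 1)]`. -/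
noncomputable def cDen (a : ℕ → ℂ) : ℕ → ℂ
  | 0 => 1
  | 1 => a 0
  | n + 2 => a (n + 1) * cDen a (n + 1) + cDen a n

/-- With `cDen_succ`, this peels off the first coefficient instead of the last, to match
`IsNearConv.succ`. -/
theorem cNum_succ (a : ℕ → ℂ) : ∀ n, cNum a (n + 1) = cDen (fun k => a (k + 1)) n
  | 0 => rfl
  | 1 => by simp [cNum, cDen]
  | n + 2 => by
    have h1 := cNum_succ a n
    have h2 := cNum_succ a (n + 1)
    rw [cNum, cDen, h1, h2]

theorem cDen_succ (a : ℕ → ℂ) : ∀ n, cDen a (n + 1) =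
    a 0 * cDen (fun k => a (k + 1)) n + cNum (fun k => a (k + 1)) n
  | 0 => by simp [cNum, cDen]
  | 1 => by simp [cNum, cDen]; ring
  | n + 2 => by
    have h1 := cDen_succ a n
    have h2 := cDen_succ a (n + 1)
    rw [cDen, h1, h2, cDen, cNum]; ring

theorem cNum_mul_cDen_succ_sub (a : ℕ → ℂ) : ∀ n,
    cNum a n * cDen a (n + 1) - cNum a (n + 1) * cDen a n = -(-1) ^ n
  | 0 => by simp [cNum, cDen]
  | n + 1 => by
    have h := cNum_mul_cDen_succ_sub a n
    rw [cDen, cNum, pow_succ]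
    linear_combination -h

theorem cNum_mem {d : ℕ} {a : ℕ → ℂ} (ha : ∀ k, a k ∈ ringO d) : ∀ n, cNum a n ∈ ringO d
  | 0 => zero_mem _
  | 1 => one_mem _
  | n + 2 => add_mem (mul_mem (ha _) (cNum_mem ha (n + 1))) (cNum_mem ha n)

theorem cDen_mem {d : ℕ} {a : ℕ → ℂ} (ha : ∀ k, a k ∈ ringO d) : ∀ n, cDen a n ∈ ringO d
  | 0 => one_mem _
  | 1 => ha 0
  | n + 2 => add_mem (mul_mem (ha _) (cDen_mem ha (n + 1))) (cDen_mem ha n)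

/-! ### The nearest integer expansion -/

/-- The coefficients of the nearest integer expansion, continued beyond its end. -/
noncomputable def nicfCoeff (d : ℕ) (z : ℂ) (k : ℕ) : ℂ := coeff d ((mapT d)^[k] z)

theorem nicfCoeff_mem {d : ℕ} (hd : d = 1 ∨ d = 2 ∨ d = 3) (z : ℂ) (k : ℕ) :
    nicfCoeff d z k ∈ ringO d := (coeff_spec hd _).1

theorem mapT_of_ne_zero {d : ℕ} {z : ℂ} (hz : z ≠ 0) : mapT d z = 1 / z - coeff d z :=
  if_neg hz

theorem mapT_mem {d : ℕ} (hd : d = 1 ∨ d = 2 ∨ d = 3) {z : ℂ} (hz : z ∈ domainU d) :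
    mapT d z ∈ domainU d := by
  by_cases h : z = 0
  · simpa [mapT, h] using hz
  · rw [mapT_of_ne_zero h]; exact (coeff_spec hd z).2

theorem iterate_mapT_mem {d : ℕ} (hd : d = 1 ∨ d = 2 ∨ d = 3) {z : ℂ} (hz : z ∈ domainU d) :
    ∀ k, (mapT d)^[k] z ∈ domainU d
  | 0 => hz
  | k + 1 => by
    rw [Function.iterate_succ_apply']; exact mapT_mem hd (iterate_mapT_mem hd hz k)

theorem isNearConv_nicf {d : ℕ} (hd : d = 1 ∨ d = 2 ∨ d = 3) : ∀ (n : ℕ) {z : ℂ},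
    z ∈ domainU d → (∀ k < n, (mapT d)^[k] z ≠ 0) →
      IsNearConv d n z (cNum (nicfCoeff d z) n) (cDen (nicfCoeff d z) n)
  | 0, _, hz, _ => .zero (domainU_subset_closedU hd hz)
  | n + 1, z, hz, h => by
    have h0 : z ≠ 0 := h 0 (Nat.succ_pos n)
    have ih := isNearConv_nicf hd n (mapT_mem hd hz)
      (fun k hk => h (k + 1) (Nat.succ_lt_succ hk))
    have e : nicfCoeff d (mapT d z) = fun k => nicfCoeff d z (k + 1) := rfl
    rw [e, mapT_of_ne_zero h0] at ih
    rw [cNum_succ, cDen_succ]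
    exact .succ (domainU_subset_closedU hd hz) h0 (coeff_spec hd z).1 ih

/-- Iterated, it expresses `qₙ z - pₙ` up to sign as the product of `z, T z, …, Tⁿ z`. -/
theorem cDen_mul_sub_cNum_succ {d : ℕ} {z : ℂ} : ∀ n : ℕ,
    (∀ k < n + 1, (mapT d)^[k] z ≠ 0) →
      cDen (nicfCoeff d z) (n + 1) * z - cNum (nicfCoeff d z) (n + 1) =
        -(mapT d)^[n + 1] z * (cDen (nicfCoeff d z) n * z - cNum (nicfCoeff d z) n)
  | 0, h => by
    have h0 : z ≠ 0 := h 0 Nat.zero_lt_one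
    have e : (mapT d)^[0 + 1] z = 1 / z - nicfCoeff d z 0 := mapT_of_ne_zero h0
    rw [e]
    simp only [cDen, cNum]
    field_simp
    ring
  | n + 1, h => by
    have ih := cDen_mul_sub_cNum_succ n (fun k hk => h k (Nat.lt_succ_of_lt hk))
    have h0 : (mapT d)^[n + 1] z ≠ 0 := h (n + 1) (Nat.lt_succ_self _)
    have e : (mapT d)^[n + 1 + 1] z = 1 / (mapT d)^[n + 1] z - nicfCoeff d z (n + 1) := by
      rw [Function.iterate_succ_apply', mapT_of_ne_zero h0]; rfl
    rw [e]
    simp only [cDen, cNum]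
    set t := (mapT d)^[n + 1] z
    have e2 : 1 / t * (cDen (nicfCoeff d z) (n + 1) * z - cNum (nicfCoeff d z) (n + 1)) =
        -(cDen (nicfCoeff d z) n * z - cNum (nicfCoeff d z) n) := by
      rw [ih]; field_simp
    linear_combination e2

theorem normSq_cDen_mul_sub_cNum_le {d : ℕ} (hd : d = 1 ∨ d = 2 ∨ d = 3) {z : ℂ}
    (hz : z ∈ domainU d) : ∀ n : ℕ, (∀ k < n, (mapT d)^[k] z ≠ 0) →
      Complex.normSq (cDen (nicfCoeff d z) n * z - cNum (nicfCoeff d z) n) ≤ (3 / 4) ^ n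
  | 0, _ => by
    have := normSq_le_of_mem_closedU hd (domainU_subset_closedU hd hz)
    simp only [cDen, cNum, one_mul, sub_zero, pow_zero]
    linarith
  | n + 1, h => by
    have ih := normSq_cDen_mul_sub_cNum_le hd hz n (fun k hk => h k (Nat.lt_succ_of_lt hk))
    have h1 := normSq_le_of_mem_closedU hd
      (domainU_subset_closedU hd (iterate_mapT_mem hd hz (n + 1)))
    rw [cDen_mul_sub_cNum_succ n h, Complex.normSq_mul, Complex.normSq_neg, pow_succ, mul_comm]
    exact mul_le_mul ih h1 (Complex.normSq_nonneg _) (by positivity)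

theorem nicf_get? {d : ℕ} {z : ℂ} {k : ℕ} (h : (mapT d)^[k] z ≠ 0) :
    (nicf d z).1.s.get? k = some ⟨1, nicfCoeff d z k⟩ := if_neg h

theorem nicf_terminatedAt_iff {d : ℕ} {z : ℂ} {k : ℕ} :
    (nicf d z).1.TerminatedAt k ↔ (mapT d)^[k] z = 0 := by
  change (if (mapT d)^[k] z = 0 then none else some _) = none ↔ _
  split_ifs with h <;> simp [h]

theorem nicf_nums_and_dens {d : ℕ} {z : ℂ} : ∀ n : ℕ, (∀ k < n, (mapT d)^[k] z ≠ 0) →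
    (nicf d z).1.nums n = cNum (nicfCoeff d z) n ∧ (nicf d z).1.dens n = cDen (nicfCoeff d z) n
  | 0, _ => ⟨GenContFract.zeroth_num_eq_h, GenContFract.zeroth_den_eq_one⟩
  | 1, h => by
    have e := nicf_get? (h 0 Nat.zero_lt_one)
    constructor
    · rw [GenContFract.first_num_eq e]
      simp [cNum, nicf]
    · rw [GenContFract.first_den_eq e]
      simp [cDen]
  | n + 2, h => by
    obtain ⟨h1, h2⟩ := nicf_nums_and_dens n (fun k hk => h k (by omega))
    obtain ⟨h3, h4⟩ := nicf_nums_and_dens (n + 1) (fun k hk => h k (by omega))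
    have e := nicf_get? (h (n + 1) (by omega))
    rw [GenContFract.nums_recurrence e h1 h3, GenContFract.dens_recurrence e h2 h4]
    simp [cNum, cDen]

theorem convergent_nicf {d : ℕ} (hd : d = 1 ∨ d = 2 ∨ d = 3) {z : ℂ} (hz : z ∈ domainU d)
    {n : ℕ} (h : ∀ k < n, (mapT d)^[k] z ≠ 0) :
    convergent (nicf d z) n =
      ((cNum (nicfCoeff d z) n / cDen (nicfCoeff d z) n : ℂ) : OnePoint ℂ) := by
  obtain ⟨h1, h2⟩ := nicf_nums_and_dens n h
  rw [convergent, h1, h2, if_neg ((isNearConv_nicf hd n hz h).den_ne_zero hd)]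

theorem nicf_isExpansion {d : ℕ} (hd : d = 1 ∨ d = 2 ∨ d = 3) {z : ℂ} (hz : z ∈ domainU d) :
    IsExpansion d (nicf d z) z where
  head_mem := zero_mem _
  coeff_mem k a h := by
    rw [GenContFract.partDens, Stream'.Seq.map_get?] at h
    obtain ⟨p, hp, rfl⟩ := Option.map_eq_some_iff.1 h
    by_cases h0 : (mapT d)^[k] z = 0
    · rw [nicf_terminatedAt_iff.2 h0] at hp
      cases hp
    · rw [nicf_get? h0] at hp
      cases hp
      exact nicfCoeff_mem hd z k
  finite_value n hlt hn := by
    simp only [nicf_terminatedAt_iff] at hlt hn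
    have hq := (isNearConv_nicf hd n hz hlt).den_ne_zero hd
    rw [convergent_nicf hd hz hlt]
    congr 1
    rw [div_eq_iff hq]
    cases n with
    | zero =>
      have hn : z = 0 := hn
      simp [cNum, hn]
    | succ n =>
      have := cDen_mul_sub_cNum_succ n hlt
      rw [hn] at this
      linear_combination -this
  infinite_value hinf := by
    have h0 : ∀ k, (mapT d)^[k] z ≠ 0 := fun k hk => hinf ⟨k, nicf_terminatedAt_iff.2 hk⟩
    have e : convergent (nicf d z) = fun n => ((cNum (nicfCoeff d z) n /
        cDen (nicfCoeff d z) n : ℂ) : OnePoint ℂ) :=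
      funext fun n => convergent_nicf hd hz (fun k _ => h0 k)
    rw [e]
    refine (OnePoint.continuous_coe.tendsto z).comp ?_
    rw [tendsto_iff_norm_sub_tendsto_zero]
    have hlim : Filter.Tendsto (fun n : ℕ => Real.sqrt ((3 / 4 : ℝ) ^ n)) Filter.atTop
        (nhds 0) := by
      have := (Real.continuous_sqrt.tendsto 0).comp
        (tendsto_pow_atTop_nhds_zero_of_lt_one (r := (3 / 4 : ℝ)) (by norm_num) (by norm_num))
      rwa [Real.sqrt_zero] at this
    refine squeeze_zero (fun _ => norm_nonneg _) (fun n => ?_) hlim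
    have hq := (isNearConv_nicf hd n hz (fun k _ => h0 k)).den_ne_zero hd
    have h1 := one_le_normSq hd (cDen_mem (nicfCoeff_mem hd z) n) hq
    have h2 := normSq_cDen_mul_sub_cNum_le hd hz n (fun k _ => h0 k)
    have e3 : cNum (nicfCoeff d z) n / cDen (nicfCoeff d z) n - z =
        -(cDen (nicfCoeff d z) n * z - cNum (nicfCoeff d z) n) / cDen (nicfCoeff d z) n := by
      field_simp; ring
    refine Real.le_sqrt_of_sq_le ?_
    rw [← Complex.normSq_eq_norm_sq, e3, Complex.normSq_div, Complex.normSq_neg]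
    exact (div_le_self (Complex.normSq_nonneg _) h1).trans h2

/-! ### Finiteness for elements of the field -/

/-- The Euclidean algorithm: `T` sends `p / q` to `(q - a p) / p`, and `|p|² < |q|²` since `p / q`
is in the cell. -/
theorem exists_iterate_mapT_eq_zero {d : ℕ} (hd : d = 1 ∨ d = 2 ∨ d = 3) (k : ℕ) :
    ∀ p q : ℂ, p ∈ ringO d → q ∈ ringO d → q ≠ 0 → p / q ∈ domainU d →
      Complex.normSq q < k → ∃ n, (mapT d)^[n] (p / q) = 0 := by
  induction k with
  | zero =>
    intro p q _ _ _ _ h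
    have := Complex.normSq_nonneg q
    push_cast at h; linarith
  | succ k ih =>
    intro p q hp hq hq0 hz hk
    by_cases hp0 : p = 0
    · exact ⟨0, by simp [hp0]⟩
    have hlt : Complex.normSq p < Complex.normSq q := by
      have h1 := normSq_le_of_mem_closedU hd (domainU_subset_closedU hd hz)
      have h2 := Complex.normSq_pos.2 hq0
      rw [Complex.normSq_div, div_le_iff₀ h2] at h1
      linarith
    have hlt' : Complex.normSq p < k := by
      obtain ⟨a, ha⟩ := exists_normSq_eq_intCast hd hp
      obtain ⟨b, hb⟩ := exists_normSq_eq_intCast hd hq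
      rw [ha, hb] at hlt
      rw [hb] at hk
      rw [ha]
      have h1 : a < b := by exact_mod_cast hlt
      have h2 : b < k + 1 := by exact_mod_cast hk
      have : a < k := by omega
      exact_mod_cast this
    have e : mapT d (p / q) = (q - coeff d (p / q) * p) / p := by
      rw [mapT_of_ne_zero (div_ne_zero hp0 hq0)]
      field_simp
    obtain ⟨n, hn⟩ := ih (q - coeff d (p / q) * p) p
      (sub_mem hq (mul_mem (coeff_spec hd _).1 hp)) hp hp0 (e ▸ mapT_mem hd hz) hlt'
    exact ⟨n + 1, by rw [Function.iterate_succ_apply, e, hn]⟩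

theorem sqrt_mul_I_mem_ringO {d : ℕ} (hd : d = 1 ∨ d = 2 ∨ d = 3) :
    (Real.sqrt d : ℂ) * Complex.I ∈ ringO d := by
  rcases hd with rfl | rfl | rfl
  · exact mem_ringO_one.2 ⟨0, 1, by simp, by simp⟩
  · exact mem_ringO_two.2 ⟨0, 1, by simp, by simp⟩
  · exact mem_ringO_three.2 ⟨-1, 2, by simp, by simp [mul_div_cancel₀]⟩

theorem exists_eq_div_of_mem_fieldK {d : ℕ} (hd : d = 1 ∨ d = 2 ∨ d = 3) {z : ℂ}
    (hz : z ∈ fieldK d) : ∃ p ∈ ringO d, ∃ q ∈ ringO d, q ≠ 0 ∧ z = p / q := by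
  refine IntermediateField.adjoin_induction ℚ
    (p := fun z _ => ∃ p ∈ ringO d, ∃ q ∈ ringO d, q ≠ 0 ∧ z = p / q) ?_ ?_ ?_ ?_ ?_ hz
  · rintro x rfl
    exact ⟨_, sqrt_mul_I_mem_ringO hd, 1, one_mem _, one_ne_zero, by simp⟩
  · intro x
    refine ⟨x.num, intCast_mem _ _, x.den, natCast_mem _ _, by exact_mod_cast x.den_ne_zero, ?_⟩
    simp [Rat.cast_def]
  · rintro _ _ _ _ ⟨p, hp, q, hq, hq0, rfl⟩ ⟨r, hr, s, hs, hs0, rfl⟩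
    exact ⟨p * s + r * q, add_mem (mul_mem hp hs) (mul_mem hr hq), q * s, mul_mem hq hs,
      mul_ne_zero hq0 hs0, by field_simp⟩
  · rintro _ _ ⟨p, hp, q, hq, hq0, rfl⟩
    by_cases h : p = 0
    · exact ⟨0, zero_mem _, 1, one_mem _, one_ne_zero, by simp [h]⟩
    · exact ⟨q, hq, p, hp, h, by rw [inv_div]⟩
  · rintro _ _ _ _ ⟨p, hp, q, hq, hq0, rfl⟩ ⟨r, hr, s, hs, hs0, rfl⟩
    exact ⟨p * r, mul_mem hp hr, q * s, mul_mem hq hs, mul_ne_zero hq0 hs0, by field_simp⟩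

theorem nicf_terminates {d : ℕ} (hd : d = 1 ∨ d = 2 ∨ d = 3) {z : ℂ} (hz : z ∈ domainU d)
    (hK : z ∈ fieldK d) : (nicf d z).1.Terminates := by
  obtain ⟨p, hp, q, hq, hq0, rfl⟩ := exists_eq_div_of_mem_fieldK hd hK
  obtain ⟨k, hk⟩ := exists_nat_gt (Complex.normSq q)
  obtain ⟨n, hn⟩ := exists_iterate_mapT_eq_zero hd k p q hp hq hq0 hz hk
  exact ⟨n, nicf_terminatedAt_iff.2 hn⟩

/-! ### Walks in the Farey graph -/

theorem det_eq_one {d : ℕ} (A : SL(2, ringO d)) :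
    (A.1 0 0 : ℂ) * A.1 1 1 - A.1 0 1 * A.1 1 0 = 1 := by
  have h := A.2
  rw [Matrix.det_fin_two] at h
  exact_mod_cast congrArg (Subtype.val) h

theorem moebius_mul_swapS_infty {d : ℕ} (A : SL(2, ringO d)) :
    moebius (A * swapS d) ∞ = moebius A ((0 : ℂ) : OnePoint ℂ) := by
  rw [moebius_mul, moebius_swapS_infty]

theorem mul_swapS_apply {d : ℕ} (A : SL(2, ringO d)) (i : Fin 2) :
    (A * swapS d).1 i 0 = A.1 i 1 := by
  change (A.1 * (swapS d).1) i 0 = _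
  simp [swapS, Matrix.mul_apply, Fin.sum_univ_two]

/-- Proportional first columns make `B⁻¹ A` upper triangular. The factor `e` is its upper left
entry, inverse to that of `A⁻¹ B`, hence a unit. -/
theorem eq_unit_mul_of_moebius_infty_eq {d : ℕ} (hd : d = 1 ∨ d = 2 ∨ d = 3)
    {A B : SL(2, ringO d)} (h : moebius A ∞ = moebius B ∞) :
    ∃ e : ℂ, Complex.normSq e = 1 ∧ (A.1 0 0 : ℂ) = e * B.1 0 0 ∧
      (A.1 1 0 : ℂ) = e * B.1 1 0 := by
  have hA := det_eq_one A
  have hB := det_eq_one B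
  have h0 : (A.1 0 0 : ℂ) * B.1 1 0 - A.1 1 0 * B.1 0 0 = 0 := by
    rw [moebius_infty, moebius_infty] at h
    split_ifs at h with h1 h2 h2
    · rw [h1, h2]; ring
    · exact absurd h (OnePoint.infty_ne_coe _)
    · exact absurd h (OnePoint.coe_ne_infty _)
    · have h3 := OnePoint.coe_injective h
      rw [div_eq_div_iff h1 h2] at h3
      linear_combination h3
  have he : (B.1 1 1 * A.1 0 0 - B.1 0 1 * A.1 1 0 : ℂ) *
      (A.1 1 1 * B.1 0 0 - A.1 0 1 * B.1 1 0) = 1 := by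
    linear_combination hA * (B.1 0 0 * B.1 1 1 - B.1 0 1 * B.1 1 0 : ℂ) + hB +
      (A.1 0 1 * B.1 1 1 - B.1 0 1 * A.1 1 1 : ℂ) * (-h0)
  have hm1 : (B.1 1 1 * A.1 0 0 - B.1 0 1 * A.1 1 0 : ℂ) ∈ ringO d :=
    (B.1 1 1 * A.1 0 0 - B.1 0 1 * A.1 1 0).2
  have hm2 : (A.1 1 1 * B.1 0 0 - A.1 0 1 * B.1 1 0 : ℂ) ∈ ringO d :=
    (A.1 1 1 * B.1 0 0 - A.1 0 1 * B.1 1 0).2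
  refine ⟨(B.1 1 1 * A.1 0 0 - B.1 0 1 * A.1 1 0 : ℂ), ?_, ?_, ?_⟩
  · have h1 := one_le_normSq hd hm1 (left_ne_zero_of_mul_eq_one he)
    have h2 := one_le_normSq hd hm2 (right_ne_zero_of_mul_eq_one he)
    have h3 := congrArg Complex.normSq he
    rw [Complex.normSq_mul, map_one] at h3
    nlinarith
  · linear_combination (-(A.1 0 0 : ℂ)) * hB + (-(B.1 0 1 : ℂ)) * h0
  · linear_combination (-(A.1 1 0 : ℂ)) * hB + (-(B.1 1 1 : ℂ)) * h0

theorem isVec_column {d : ℕ} (A : SL(2, ringO d)) : IsVec d (A.1 0 0) (A.1 1 0) := by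
  refine ⟨(A.1 0 0).2, (A.1 1 0).2, ?_⟩
  by_contra! h
  have := det_eq_one A
  rw [h.1, h.2] at this
  simp at this

/-- Representatives of a vertex differ by a unit, so along an edge the determinant has modulus `1`.
-/
theorem chain_of_walk {d : ℕ} (hd : d = 1 ∨ d = 2 ∨ d = 3) {u v : FareyVertex d}
    (w : (fareyGraph d).Walk u v) : ∀ {A B : SL(2, ringO d)}, moebius A ∞ = u.1 →
      moebius B ∞ = v.1 →
        Chain d w.length (A.1 0 0) (A.1 1 0) (B.1 0 0) (B.1 1 0) := by
  induction w with
  | nil =>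
    intro A B hA hB
    obtain ⟨e, -, h1, h2⟩ := eq_unit_mul_of_moebius_infty_eq hd (hA.trans hB.symm)
    change _ = _
    rw [h1, h2]; ring
  | @cons u u' v hadj w ih =>
    intro A B hA hB
    obtain ⟨C, hC⟩ := u'.2
    obtain ⟨D, hD, hD'⟩ := hadj
    rw [← moebius_mul_swapS_infty] at hD'
    obtain ⟨e, he, h1, h2⟩ := eq_unit_mul_of_moebius_infty_eq hd (hA.trans hD.symm)
    obtain ⟨f, hf, h3, h4⟩ := eq_unit_mul_of_moebius_infty_eq hd (hC.trans hD'.symm)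
    rw [mul_swapS_apply] at h3 h4
    refine ⟨_, _, isVec_column C, le_of_eq ?_, ih hC hB⟩
    have hdet : (A.1 0 0 * C.1 1 0 - A.1 1 0 * C.1 0 0 : ℂ) = e * f := by
      rw [h1, h2, h3, h4]
      linear_combination (e * f) * det_eq_one D
    rw [hdet, Complex.normSq_mul, he, hf, one_mul]

/-- The matrix whose columns are, up to sign, two consecutive convergents. -/
noncomputable def convMatrix {d : ℕ} {a : ℕ → ℂ} (ha : ∀ k, a k ∈ ringO d) (n : ℕ) :
    SL(2, ringO d) :=
  ⟨!![⟨cNum a n, cNum_mem ha n⟩, -(-1) ^ n * ⟨cNum a (n + 1), cNum_mem ha (n + 1)⟩;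
      ⟨cDen a n, cDen_mem ha n⟩, -(-1) ^ n * ⟨cDen a (n + 1), cDen_mem ha (n + 1)⟩], by
    rw [Matrix.det_fin_two]
    apply Subtype.ext
    have h := cNum_mul_cDen_succ_sub a n
    have h2 : ((-1 : ℂ) ^ n) * (-1) ^ n = 1 := by rw [← mul_pow]; simp
    simp
    linear_combination (-(-1) ^ n) * h + h2⟩

theorem convMatrix_moebius_zero {d : ℕ} {a : ℕ → ℂ} (ha : ∀ k, a k ∈ ringO d) (n : ℕ) :
    moebius (convMatrix ha n) ((0 : ℂ) : OnePoint ℂ) = moebius (convMatrix ha (n + 1)) ∞ := by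
  rw [moebius_coe, moebius_infty]
  have h : ((-1 : ℂ) ^ n) ≠ 0 := pow_ne_zero _ (by norm_num)
  simp [convMatrix, h, mul_div_mul_left]

/-- The `n`-th convergent as a vertex of the Farey graph. -/
noncomputable def convVertex {d : ℕ} {a : ℕ → ℂ} (ha : ∀ k, a k ∈ ringO d) (n : ℕ) :
    FareyVertex d := ⟨moebius (convMatrix ha n) ∞, _, rfl⟩

theorem infty_adj_convVertex {d : ℕ} {a : ℕ → ℂ} (ha : ∀ k, a k ∈ ringO d) :
    (fareyGraph d).Adj (FareyVertex.infty d) (convVertex ha 0) := by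
  refine ⟨1, by simp [moebius, FareyVertex.infty], ?_⟩
  change _ = moebius (convMatrix ha 0) ∞
  rw [moebius_infty]
  simp [convMatrix, cNum, cDen, moebius]

theorem convVertex_adj_succ {d : ℕ} {a : ℕ → ℂ} (ha : ∀ k, a k ∈ ringO d) (n : ℕ) :
    (fareyGraph d).Adj (convVertex ha n) (convVertex ha (n + 1)) :=
  ⟨convMatrix ha n, rfl, convMatrix_moebius_zero ha n⟩

theorem exists_walk_convVertex {d : ℕ} {a : ℕ → ℂ} (ha : ∀ k, a k ∈ ringO d) (n : ℕ) :
    ∃ w : (fareyGraph d).Walk (FareyVertex.infty d) (convVertex ha n),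
      w.support = FareyVertex.infty d :: (List.range (n + 1)).map (convVertex ha) := by
  induction n with
  | zero => exact ⟨.cons (infty_adj_convVertex ha) .nil, rfl⟩
  | succ n ih =>
    obtain ⟨w, hw⟩ := ih
    refine ⟨w.concat (convVertex_adj_succ ha n), ?_⟩
    rw [SimpleGraph.Walk.support_concat, hw, List.range_succ (n := n + 1)]
    simp

theorem nicf_isGeodesic {d : ℕ} (hd : d = 1 ∨ d = 2 ∨ d = 3) {z : ℂ} (hz : z ∈ domainU d) :
    IsGeodesic d (nicf d z) := by
  intro n hn
  simp only [nicf_terminatedAt_iff] at hn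
  have ha := nicfCoeff_mem hd z
  obtain ⟨w, hw⟩ := exists_walk_convVertex ha n
  have hlen : w.length = n + 1 := by
    have := w.length_support
    rw [hw] at this
    simpa using this.symm
  have hmin : ∀ w' : (fareyGraph d).Walk (FareyVertex.infty d) (convVertex ha n),
      w.length ≤ w'.length := by
    intro w'
    rw [hlen]
    have hc := chain_of_walk hd w' (A := 1) (B := convMatrix ha n)
      (by simp [moebius, FareyVertex.infty]) rfl
    refine (isNearConv_nicf hd n hz hn).succ_le_of_chain hd ?_
    simpa [convMatrix] using hc
  refine ⟨_, w, ?_, ?_, hmin⟩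
  · rw [hw]
    change ∞ :: ((List.range (n + 1)).map (convVertex ha)).map
      (fun v : FareyVertex d => (Subtype.val v : OnePoint ℂ)) = _
    rw [List.map_map]
    congr 1
    refine List.map_congr_left fun k hk => ?_
    have hk' : k ≤ n := Nat.lt_succ_iff.1 (List.mem_range.1 hk)
    have hlt : ∀ j < k, (mapT d)^[j] z ≠ 0 := fun j hj => hn j (hj.trans_le hk')
    rw [convergent_nicf hd hz hlt]
    have hq := (isNearConv_nicf hd k hz hlt).den_ne_zero hd
    change moebius (convMatrix ha k) ∞ = _
    rw [moebius_infty]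
    simp [convMatrix, hq]
  -- A walk that realises the distance repeats no vertex.
  · refine w.isPath_of_length_eq_dist ?_
    obtain ⟨w', hw'⟩ := w.reachable.exists_walk_length_eq_dist
    exact le_antisymm ((hmin w').trans hw'.le) (SimpleGraph.dist_le w)

end FareyCF

theorem mainTheorem1 (d : ℕ) (hd : d = 1 ∨ d = 2 ∨ d = 3) (z : ℂ)
    (hz : z ∈ FareyCF.domainU d) :
    FareyCF.IsExpansion d (FareyCF.nicf d z) z ∧
    FareyCF.IsGeodesic d (FareyCF.nicf d z) ∧
    (z ∈ FareyCF.fieldK d → (FareyCF.nicf d z).1.Terminates) :=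
  ⟨FareyCF.nicf_isExpansion hd hz, FareyCF.nicf_isGeodesic hd hz,
    FareyCF.nicf_terminates hd hz⟩
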